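/- Let $p$ be an odd prime and let $m\ge 3$ be odd. Let $\mathrm{Tr}$ be the trace function from $\mathrm{GF}(p^m)$ to $\mathrm{GF}(p)$, let $$D=\{x\in\mathrm{GF}(p^m)^*:\mathrm{Tr}(x^{p+1}-x)=0\}=\{d_1,\dots,d_n\}$$ with $d_1,\dots,d_n$ distinct, and let $$\mathcal C_D=\{(\mathrm{Tr}(xd_1),\dots,\mathrm{Tr}(xd_n)):x\in\mathrm{GF}(p^m)\}\subseteq\mathrm{GF}(p)^n .$$ Let $\bar\eta$ be the quadratic character of $\mathrm{GF}(p)$, with $\bar\eta(0)=0$, let $m_p=m\bmod p$, and put $\varepsilon=(-1)^{\frac{p-1}{2}\cdot\frac{m-1}{2}}$ and $\delta=\bar\eta(m_p)\,\varepsilon$. Let $A_w$ be the number of codewords of $\mathcal C_D$ of Hamming weight $w$. Then $\mathcal C_D$ is a linear code over $\mathrm{GF}(p)$ of dimension $m$ and length $$n=p^{m-1}-1+\varepsilon\,\bar\eta(m_p)\,p^{\frac{m-1}{2}},$$ at most five of the numbers $A_1,\dots,A_n$ are nonzero, and the weight distribution of $\mathcal C_D$ is as follows, with $A_w=0$ for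 every $w$ that is not listed. Table 1. If $m\equiv 0\pmod p$: - $w=0$: $A_w=1$; - $w=(p-1)p^{m-2}$: $A_w=p^{m-1}-1$; - $w=(p-1)\bigl(p^{m-2}-\varepsilon p^{\frac{m-3}{2}}\bigr)$: $A_w=\frac{p-1}{2}\bigl(p^{m-2}+\varepsilon p^{\frac{m-1}{2}}\bigr)$; - $w=(p-1)\bigl(p^{m-2}+\varepsilon p^{\frac{m-3}{2}}\bigr)$: $A_w=\frac{p-1}{2}\bigl(p^{m-2}-\varepsilon p^{\frac{m-1}{2}}\bigr)$; - $w=(p-1)p^{m-2}+\varepsilon p^{\frac{m-3}{2}}$: $A_w=\frac12(p-1)^2p^{m-2}$; - $w=(p-1)p^{m-2}-\varepsilon p^{\frac{m-3}{2}}$: $A_w=\frac12(p-1)^2p^{m-2}$. Table 2. If $m\not\equiv 0\pmod p$: - $w=0$: $A_w=1$; - $w=(p-1)p^{m-2}$: $A_w=p^{m-2}-1+\delta(p-1)p^{\frac{m-3}{2}}$; - $w=(p-1)p^{m-2}+\delta p^{\frac{m-1}{2}}$: $A_w=(p-1)p^{m-2}-\delta(p-1)p^{\frac{m-3}{2}}$;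 - $w=(p-1)p^{m-2}+\delta(p+1)p^{\frac{m-3}{2}}$: $A_w=\frac12(p-1)(p-2)p^{\frac{m-3}{2}}\bigl(p^{\frac{m-1}{2}}-\delta\bigr)$; - $w=(p-1)p^{m-2}+\delta(p-1)p^{\frac{m-3}{2}}$: $A_w=\frac{p-1}{2}\bigl(p^{m-1}-\delta p^{\frac{m-1}{2}}\bigr)$; - $w=(p-1)p^{m-2}+\delta p^{\frac{m-3}{2}}$: $A_w=(p-1)p^{m-2}+\delta(p-1)^2p^{\frac{m-3}{2}}$. -/

import Mathlib

/-- The defining set `D = {x ∈ F^* : Tr(x^(p+1) - x) = 0}`, where `Tr` is the trace from the finite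
field `F` of characteristic `p` to `GF(p)`. -/
def definingSet (p : ℕ) (F : Type*) [Field F] [Algebra (ZMod p) F] : Set F :=
  {x | x ≠ 0 ∧ Algebra.trace (ZMod p) F (x ^ (p + 1) - x) = 0}

/-- The trace code `{(Tr(x d_1), …, Tr(x d_n)) : x ∈ F}` of a family `d_1, …, d_n` of elements
of `F`, as a linear subspace of `GF(p)^n`. -/
noncomputable def traceCode (p : ℕ) {F : Type*} [Field F] [Algebra (ZMod p) F] {n : ℕ}
    (d : Fin n → F) : Submodule (ZMod p) (Fin n → ZMod p) :=
  LinearMap.range (LinearMap.pi fun i =>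
    Algebra.trace (ZMod p) F ∘ₗ LinearMap.mulRight (ZMod p) (d i))

/-- `A_w`: the number of codewords of Hamming weight `w` in the code `C`. The weight is taken
in `ℤ` only so that explicit formulas with signs can be substituted for it. -/
noncomputable def weightCount {p n : ℕ} (C : Submodule (ZMod p) (Fin n → ZMod p)) (w : ℤ) : ℕ :=
  {c : Fin n → ZMod p | c ∈ C ∧ (hammingNorm c : ℤ) = w}.ncard

/-- `C` has the weight distribution given by the table `T` of pairs (weight, multiplicity):
`A_w = a` for each row `(w, a)`, and `A_w = 0` for each `w` that is not the weight of a row. -/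
def HasWeightTable {p n : ℕ} (C : Submodule (ZMod p) (Fin n → ZMod p)) (T : List (ℤ × ℚ)) :
    Prop :=
  (∀ r ∈ T, (weightCount C r.1 : ℚ) = r.2) ∧
    ∀ w : ℤ, (∀ r ∈ T, w ≠ r.1) → weightCount C w = 0

/-- The sign `(-1)^(((p-1)/2)((m-1)/2))`. -/
def codeSign (p m : ℕ) : ℤ := (-1) ^ ((p - 1) / 2 * ((m - 1) / 2))

/-- The weight table in the case `m ≡ 0 (mod p)`; here `ε = (-1)^(((p-1)/2)((m-1)/2))`. -/
def weightTableZero (p m : ℕ) (ε : ℤ) : List (ℤ × ℚ) :=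
  [(0, 1),
   ((p - 1) * p ^ (m - 2),
     p ^ (m - 1) - 1),
   ((p - 1) * (p ^ (m - 2) - ε * p ^ ((m - 3) / 2)),
     (p - 1) / 2 * (p ^ (m - 2) + ε * p ^ ((m - 1) / 2))),
   ((p - 1) * (p ^ (m - 2) + ε * p ^ ((m - 3) / 2)),
     (p - 1) / 2 * (p ^ (m - 2) - ε * p ^ ((m - 1) / 2))),
   ((p - 1) * p ^ (m - 2) + ε * p ^ ((m - 3) / 2),
     1 / 2 * (p - 1) ^ 2 * p ^ (m - 2)),
   ((p - 1) * p ^ (m - 2) - ε * p ^ ((m - 3) / 2),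
     1 / 2 * (p - 1) ^ 2 * p ^ (m - 2))]

/-- The weight table in the case `m ≢ 0 (mod p)`; here `δ` is `(-1)^(((p-1)/2)((m-1)/2))` times
the value of the quadratic character of `GF(p)` at `m mod p`. -/
def weightTableNonzero (p m : ℕ) (δ : ℤ) : List (ℤ × ℚ) :=
  [(0, 1),
   ((p - 1) * p ^ (m - 2),
     p ^ (m - 2) - 1 + δ * (p - 1) * p ^ ((m - 3) / 2)),
   ((p - 1) * p ^ (m - 2) + δ * p ^ ((m - 1) / 2),
     p ^ (m - 2) * (p - 1) - δ * (p - 1) * p ^ ((m - 3) / 2)),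
   ((p - 1) * p ^ (m - 2) + δ * (p + 1) * p ^ ((m - 3) / 2),
     1 / 2 * (p - 1) * (p - 2) * p ^ ((m - 3) / 2) * (p ^ ((m - 1) / 2) - δ)),
   ((p - 1) * p ^ (m - 2) + δ * (p - 1) * p ^ ((m - 3) / 2),
     (p - 1) / 2 * (p ^ (m - 1) - δ * p ^ ((m - 1) / 2))),
   ((p - 1) * p ^ (m - 2) + δ * p ^ ((m - 3) / 2),
     (p - 1) * p ^ (m - 2) + δ * (p - 1) ^ 2 * p ^ ((m - 3) / 2))]

/-!
Over `K = GF(p)` the map `Q(x) = Tr(x^(p+1))` is a quadratic form on `F = GF(p^m)`, with polar form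
`P(x, y) = Tr(x y^p + y x^p)`, nondegenerate because `m` is odd. Since `P(1/2, y) = Tr(y)` and
`Q(1/2) = m/4`, the substitution `x = 1/2 - y` turns `Tr(x^(p+1) - x) = 0` into `Q(y) = m/4`. If `z`
is the element with `Tr(b y) = P(z, y)` for all `y`, then `Tr(b x) = 0` becomes `P(z, y) = Tr(z)`.
So the length of the code counts the points of the quadric `Q = m/4`, and the weight of the codeword
of `b` is this count less the count of a hyperplane section (`hammingNorm_traceCodeword`). The size
of the section depends only on `Q(z)` and `Tr(z) = P(1/2, z)`, so how often each weight occurs is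
again a count of points with prescribed `Q` and `P(1/2, ·)`: hyperplane sections also give the
multiplicities (`card_frobeniusForm_trace_of_eq_zero`, `card_frobeniusForm_trace_of_ne_zero`).

The sections are counted with additive characters `ψ` of `K`. All that is needed is
`∑ ψ(a Q(y)) = η(a) C g` for `a ≠ 0`, with `g` the quadratic Gauss sum of `K` and
`C = ε p^((m-1)/2)` (`HasGaussFactor`). To obtain it, `x^(p+1)` and `x²` take each value equally
often as `gcd(p + 1, p^m - 1) = 2` (`exists_bijective_pow_sq_eq`), so `Q` may be replaced by the
trace form `Tr(x²)`. Diagonalizing the latter gives `η(a) η(disc) g^m`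
(`sum_addChar_mul_trace_sq`), and the discriminant of a Galois extension of odd degree is a square
(`isSquare_discr_of_odd_finrank`). Finally `g² = η(-1) p` makes `g^m` explicit.
-/

open Finset

/-! ### Quadratic character sums -/

/-- The quadratic Gauss sum `∑ η(x) ψ(x)` of a finite field `K`, with `η` the quadratic
character of `K`. -/
noncomputable def quadGaussSum {K : Type*} [Field K] [Fintype K] [DecidableEq K]
    (ψ : AddChar K ℂ) : ℂ :=
  ∑ x, (quadraticChar K x : ℂ) * ψ x

section CharacterSums

variable {K : Type*} [Field K] [Fintype K] [DecidableEq K] {ψ : AddChar K ℂ}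

theorem quadGaussSum_eq_gaussSum (ψ : AddChar K ℂ) :
    quadGaussSum ψ = gaussSum ((quadraticChar K).ringHomComp (Int.castRingHom ℂ)) ψ := by
  simp [quadGaussSum, gaussSum]

theorem quadGaussSum_sq (hK : ringChar K ≠ 2) (hψ : ψ.IsPrimitive) :
    quadGaussSum ψ ^ 2 = (quadraticChar K (-1) : ℂ) * Fintype.card K := by
  rw [quadGaussSum_eq_gaussSum, gaussSum_sq _ _ hψ]
  · simp
  · intro h
    exact (MulChar.ringHomComp_ne_one_iff (Int.castRingHom ℂ).injective_int).2
      (quadraticChar_ne_one hK) h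
  · exact (quadraticChar_isQuadratic K).comp _

theorem sum_quadraticChar_mul_addChar (hK : ringChar K ≠ 2) (s : K) :
    ∑ a, (quadraticChar K a : ℂ) * ψ (a * s) = quadraticChar K s * quadGaussSum ψ := by
  rcases eq_or_ne s 0 with rfl | hs
  · have := quadraticChar_sum_zero hK
    simp only [mul_zero, AddChar.map_zero_eq_one, mul_one, MulChar.map_zero, Int.cast_zero,
      zero_mul]
    exact_mod_cast this
  · rw [quadGaussSum, mul_sum, ← Equiv.sum_comp (Equiv.mulRight₀ s hs)
      (fun x => (quadraticChar K s : ℂ) * ((quadraticChar K x : ℂ) * ψ x))]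
    refine sum_congr rfl fun a _ => ?_
    have h : (quadraticChar K s : ℂ) * quadraticChar K s = 1 := by
      rw [← sq]
      exact_mod_cast quadraticChar_sq_one hs
    simp only [Equiv.mulRight₀_apply, map_mul, Int.cast_mul]
    linear_combination (-(quadraticChar K a : ℂ) * ψ (a * s)) * h

theorem sum_addChar_mul_sq (hK : ringChar K ≠ 2) (hψ : ψ.IsPrimitive) {a : K} (ha : a ≠ 0) :
    ∑ x, ψ (a * x ^ 2) = quadraticChar K a * quadGaussSum ψ := by
  have h : ∀ u : K, (#{x : K | x ^ 2 = u} : ℂ) = quadraticChar K u + 1 := by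
    intro u
    have := quadraticChar_card_sqrts hK u
    rw [Set.toFinset_ofPred] at this
    exact_mod_cast this
  rw [← sum_quadraticChar_mul_addChar hK,
    ← sum_fiberwise_of_maps_to (s := univ) (t := univ) (g := fun x : K => x ^ 2) (by simp)]
  have h2 : ∑ u, ψ (u * a) = 0 := by
    rw [AddChar.sum_mulShift a hψ]
    simp [ha]
  calc ∑ u, ∑ x with x ^ 2 = u, ψ (a * x ^ 2)
      = ∑ u, ((quadraticChar K u : ℂ) * ψ (u * a) + ψ (u * a)) := by
        refine sum_congr rfl fun u _ => ?_
        rw [sum_congr rfl (g := fun _ => ψ (u * a))]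
        · rw [sum_const, nsmul_eq_mul, h]
          ring
        · intro x hx
          rw [(mem_filter.1 hx).2, mul_comm]
    _ = _ := by rw [sum_add_distrib, h2, add_zero]

theorem sum_addChar_quadratic (hK : ringChar K ≠ 2) (hψ : ψ.IsPrimitive) {a : K} (ha : a ≠ 0)
    (b : K) :
    ∑ x, ψ (a * x ^ 2 + b * x) =
      quadraticChar K a * quadGaussSum ψ * ψ (-(b ^ 2 / (4 * a))) := by
  have h2 : (2 : K) ≠ 0 := Ring.two_ne_zero hK
  have h4 : (4 : K) ≠ 0 := by
    have : (4 : K) = 2 * 2 := by norm_num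
    rw [this]
    exact mul_ne_zero h2 h2
  rw [← sum_addChar_mul_sq hK hψ ha, sum_mul,
    ← Equiv.sum_comp (Equiv.addRight (b / (2 * a))) (fun x => ψ (a * x ^ 2) * _)]
  refine sum_congr rfl fun x _ => ?_
  rw [← AddChar.map_add_eq_mul]
  congr 1
  simp only [Equiv.coe_addRight]
  field_simp
  ring

theorem sum_addChar_mul_eq_ite (hψ : ψ.IsPrimitive) (b : K) :
    ∑ x, ψ (x * b) = if b = 0 then (Fintype.card K : ℂ) else 0 := by
  rw [AddChar.sum_mulShift b hψ]
  split_ifs <;> simp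

end CharacterSums

/-! ### Points of quadrics and of their hyperplane sections -/

section QuadricCounts

open QuadraticMap

theorem sum_addChar_polar {K V : Type*} [Field K] [AddCommGroup V] [Module K V] [Fintype V]
    {ψ : AddChar K ℂ} {Q : QuadraticForm K V} (hψ : ψ.IsPrimitive) {z : V}
    (hz : ∃ y, polar Q z y ≠ 0) {b : K} (hb : b ≠ 0) : ∑ y, ψ (b * polar Q z y) = 0 := by
  obtain ⟨y, hy⟩ := hz
  let φ : AddChar V ℂ := ψ.compAddMonoidHom (b • Q.polarBilin z).toAddMonoidHom
  have hφ : ∀ v, φ v = ψ (b * polar Q z v) := fun v => rfl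
  simp only [← hφ]
  refine AddChar.sum_eq_zero_of_ne_one fun h => hψ one_ne_zero ?_
  ext c
  have h1 := hφ ((c / (b * polar Q z y)) • y)
  rw [h, AddChar.one_apply, polar_smul_right, smul_eq_mul] at h1
  rw [AddChar.mulShift_apply, AddChar.one_apply, h1]
  congr 1
  field_simp

variable {K : Type*} [Field K] [Fintype K] [DecidableEq K] {ψ : AddChar K ℂ}
  {V : Type*} [AddCommGroup V] [Module K V] [Fintype V] {Q : QuadraticForm K V} {C : ℂ}

/-- `C` is the *Gauss factor* of the quadratic form `Q` when `∑ ψ(a Q(y)) = η(a) C g` for all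
`a ≠ 0`, where `g` is the quadratic Gauss sum of `K`. This is the shape that the exponential sums
of a nondegenerate form in an odd number of variables take. Counting points on the quadrics of `Q`
uses nothing else, and for their hyperplane sections only `P(z, ·) ≠ 0` in addition. -/
def HasGaussFactor (ψ : AddChar K ℂ) (Q : QuadraticForm K V) (C : ℂ) : Prop :=
  ∀ a : K, a ≠ 0 → ∑ y, ψ (a * Q y) = quadraticChar K a * (C * quadGaussSum ψ)

theorem quadraticChar_neg_one_sq_cast : (quadraticChar K (-1) : ℂ) ^ 2 = 1 := by
  have h : quadraticChar K (-1) ^ 2 = 1 := quadraticChar_sq_one (neg_ne_zero.2 one_ne_zero)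
  exact_mod_cast h

theorem quadGaussSum_sq_mul_neg (hK : ringChar K ≠ 2) (hψ : ψ.IsPrimitive) (s : K) :
    (quadraticChar K (-s) : ℂ) * quadGaussSum ψ ^ 2 = quadraticChar K s * Fintype.card K := by
  rw [quadGaussSum_sq hK hψ, neg_eq_neg_one_mul, map_mul]
  push_cast
  linear_combination (quadraticChar K s : ℂ) * Fintype.card K *
    quadraticChar_neg_one_sq_cast (K := K)

theorem HasGaussFactor.card_eq (hQ : HasGaussFactor ψ Q C) (hK : ringChar K ≠ 2)
    (hψ : ψ.IsPrimitive) (s : K) :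
    (Fintype.card K : ℂ) * #{y | Q y = s} =
      Fintype.card V + Fintype.card K * (C * quadraticChar K s) := by
  have hf : ∀ a : K, ∑ y, ψ (a * Q y) =
      (if a = 0 then (Fintype.card V : ℂ) else 0) +
        quadraticChar K a * (C * quadGaussSum ψ) := by
    intro a
    split_ifs with ha
    · simp [ha]
    · rw [hQ a ha, zero_add]
  calc (Fintype.card K : ℂ) * #{y | Q y = s}
      = ∑ y, ∑ a, ψ (a * (Q y - s)) := by
        simp only [sum_addChar_mul_eq_ite hψ, sub_eq_zero, ← sum_filter, sum_const, nsmul_eq_mul,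
          mul_comm]
    _ = ∑ a, ψ (a * -s) * ∑ y, ψ (a * Q y) := by
        rw [sum_comm]
        refine sum_congr rfl fun a _ => ?_
        rw [mul_sum]
        refine sum_congr rfl fun y _ => ?_
        rw [← AddChar.map_add_eq_mul]
        congr 1
        ring
    _ = Fintype.card V +
          (∑ a, (quadraticChar K a : ℂ) * ψ (a * -s)) * (C * quadGaussSum ψ) := by
        simp only [hf, mul_add, sum_add_distrib, mul_ite, mul_zero, sum_ite_eq', mem_univ, if_true,
          zero_mul, AddChar.map_zero_eq_one, one_mul, sum_mul]
        congr 1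
        exact sum_congr rfl fun a _ => by ring
    _ = _ := by
        rw [sum_quadraticChar_mul_addChar hK]
        linear_combination C * quadGaussSum_sq_mul_neg hK hψ s

/-- The right-hand side covers `a = 0` as well: the second summand then vanishes with `η(0) = 0`. -/
theorem HasGaussFactor.sum_add_polar (hQ : HasGaussFactor ψ Q C) (hψ : ψ.IsPrimitive)
    {z : V} (hz : ∃ y, polar Q z y ≠ 0) (a b : K) :
    ∑ y, ψ (a * Q y + b * polar Q z y) =
      (if a = 0 then if b = 0 then (Fintype.card V : ℂ) else 0 else 0) +
        quadraticChar K a * (C * quadGaussSum ψ) * ψ (-(b ^ 2 / a * Q z)) := by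
  rcases eq_or_ne a 0 with rfl | ha
  · rcases eq_or_ne b 0 with rfl | hb
    · simp
    · simp [hb, sum_addChar_polar hψ hz hb]
  · rw [if_neg ha, zero_add, ← hQ a ha, sum_mul,
      ← Equiv.sum_comp (Equiv.addRight ((b / a) • z)) (fun y => ψ (a * Q y) * _)]
    refine sum_congr rfl fun y _ => ?_
    rw [← AddChar.map_add_eq_mul]
    congr 1
    have : Q (y + (b / a) • z) = Q y + Q ((b / a) • z) + polar Q y ((b / a) • z) := by
      simp [polar]
    rw [Equiv.coe_addRight, this, QuadraticMap.map_smul, polar_smul_right, polar_comm Q y z]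
    simp only [smul_eq_mul]
    field_simp
    ring

/-- Only the twist by `a ≠ 0` and the trivial character contribute to the orthogonality relations,
and for `a ≠ 0` completing the square absorbs the linear form `P(z, ·)`. -/
theorem HasGaussFactor.card_inter_hyperplane_eq_sum (hQ : HasGaussFactor ψ Q C)
    (hψ : ψ.IsPrimitive) {z : V} (hz : ∃ y, polar Q z y ≠ 0) (s t : K) :
    (Fintype.card K : ℂ) ^ 2 * #{y | Q y = s ∧ polar Q z y = t} =
      Fintype.card V + C * quadGaussSum ψ * ∑ a, quadraticChar K a * ψ (a * -s) *
        ∑ b, ψ (-(Q z / a) * b ^ 2 + -t * b) := by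
  calc (Fintype.card K : ℂ) ^ 2 * #{y | Q y = s ∧ polar Q z y = t}
      = ∑ y, (∑ a, ψ (a * (Q y - s))) * ∑ b, ψ (b * (polar Q z y - t)) := by
        simp only [sum_addChar_mul_eq_ite hψ, sub_eq_zero, ite_mul, mul_ite, zero_mul, mul_zero,
          ← ite_and]
        rw [← sum_filter, sum_const, nsmul_eq_mul]
        simp only [and_comm]
        ring
    _ = ∑ a, ∑ b, ψ (a * -s) * ψ (-t * b) * ∑ y, ψ (a * Q y + b * polar Q z y) := by
        simp only [sum_mul_sum]
        rw [sum_comm]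
        refine sum_congr rfl fun a _ => ?_
        rw [sum_comm]
        refine sum_congr rfl fun b _ => ?_
        rw [mul_sum]
        refine sum_congr rfl fun y _ => ?_
        simp only [← AddChar.map_add_eq_mul]
        congr 1
        ring
    _ = _ := by
        simp only [hQ.sum_add_polar hψ hz, mul_add, sum_add_distrib]
        congr 1
        · rw [sum_eq_single 0, sum_eq_single 0]
          · simp
          · intro b _ hb
            simp [hb]
          · simp
          · intro a _ ha
            simp [ha]
          · simp
        · rw [mul_sum]
          refine sum_congr rfl fun a _ => ?_
          rw [mul_sum, mul_sum]
          refine sum_congr rfl fun b _ => ?_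
          rw [AddChar.map_add_eq_mul, show -(Q z / a) * b ^ 2 = -(b ^ 2 / a * Q z) by ring]
          ring

/-- The hyperplane section `P(z, y) = t` of the quadric `Q(y) = s`, for isotropic `z`. -/
theorem HasGaussFactor.card_inter_hyperplane_of_isotropic (hQ : HasGaussFactor ψ Q C)
    (hK : ringChar K ≠ 2) (hψ : ψ.IsPrimitive) {z : V} (hz : ∃ y, polar Q z y ≠ 0)
    (h0 : Q z = 0) (s t : K) :
    (Fintype.card K : ℂ) ^ 2 * #{y | Q y = s ∧ polar Q z y = t} =
      Fintype.card V + if t = 0 then Fintype.card K ^ 2 * (C * quadraticChar K s) else 0 := by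
  rw [hQ.card_inter_hyperplane_eq_sum hψ hz]
  have hb : ∀ a : K, ∑ b, ψ (-(Q z / a) * b ^ 2 + -t * b) =
      if t = 0 then (Fintype.card K : ℂ) else 0 := by
    intro a
    have := sum_addChar_mul_eq_ite hψ (-t)
    simp only [neg_eq_zero] at this
    rw [← this]
    refine sum_congr rfl fun b _ => ?_
    congr 1
    rw [h0]
    ring
  simp only [hb, ← sum_mul, sum_quadraticChar_mul_addChar hK]
  split_ifs
  · linear_combination C * Fintype.card K * quadGaussSum_sq_mul_neg hK hψ s
  · simp

/-- The hyperplane section `P(z, y) = t` of the quadric `Q(y) = s`, for anisotropic `z`. The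
hyperplane is tangent when `t² = 4 Q(z) s`. -/
theorem HasGaussFactor.card_inter_hyperplane_of_anisotropic (hQ : HasGaussFactor ψ Q C)
    (hK : ringChar K ≠ 2) (hψ : ψ.IsPrimitive) {z : V} (hz : ∃ y, polar Q z y ≠ 0)
    (h0 : Q z ≠ 0) (s t : K) :
    (Fintype.card K : ℂ) ^ 2 * #{y | Q y = s ∧ polar Q z y = t} =
      Fintype.card V + Fintype.card K * (C * quadraticChar K (Q z)) *
        ((if t ^ 2 = 4 * Q z * s then (Fintype.card K : ℂ) else 0) - 1) := by
  have h2 : (2 : K) ≠ 0 := Ring.two_ne_zero hK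
  have h4 : (4 : K) ≠ 0 := by
    have : (4 : K) = 2 * 2 := by norm_num
    rw [this]
    exact mul_ne_zero h2 h2
  rw [hQ.card_inter_hyperplane_eq_sum hψ hz]
  -- The characters `η(a)` and `η(-Q(z)/a)` multiply to the constant `η(-Q(z))`.
  have ha : ∀ a : K, quadraticChar K a * ψ (a * -s) * ∑ b, ψ (-(Q z / a) * b ^ 2 + -t * b) =
      quadraticChar K (-Q z) * quadGaussSum ψ *
        (ψ (a * (t ^ 2 / (4 * Q z) - s)) - if a = 0 then 1 else 0) := by
    intro a
    rcases eq_or_ne a 0 with rfl | ha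
    · simp
    · have h : (quadraticChar K a : ℂ) * quadraticChar K (-(Q z / a)) =
          quadraticChar K (-Q z) := by
        rw [← Int.cast_mul, ← map_mul]
        congr 2
        field_simp
      rw [sum_addChar_quadratic hK hψ (neg_ne_zero.2 (div_ne_zero h0 ha)), if_neg ha, sub_zero,
        ← h, show a * (t ^ 2 / (4 * Q z) - s) =
          a * -s + -((-t) ^ 2 / (4 * -(Q z / a))) by field_simp; ring,
        AddChar.map_add_eq_mul]
      ring
  simp only [ha, ← mul_sum, sum_sub_distrib, sum_addChar_mul_eq_ite hψ, sum_ite_eq', mem_univ,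
    if_true]
  have hiff : t ^ 2 / (4 * Q z) - s = 0 ↔ t ^ 2 = 4 * Q z * s := by
    rw [sub_eq_zero, div_eq_iff (mul_ne_zero h4 h0), mul_comm s]
  simp only [hiff]
  linear_combination C * ((if t ^ 2 = 4 * Q z * s then (Fintype.card K : ℂ) else 0) - 1) *
    quadGaussSum_sq_mul_neg hK hψ (Q z)

end QuadricCounts

/-! ### Gauss sums of the trace form -/

section TraceForm

theorem AddChar.map_sum_eq_prod {A M ι : Type*} [AddCommMonoid A] [CommMonoid M] (ψ : AddChar A M)
    (s : Finset ι) (f : ι → A) : ψ (∑ i ∈ s, f i) = ∏ i ∈ s, ψ (f i) := by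
  classical
  induction s using Finset.induction_on with
  | empty => simp
  | insert i s hi ih => rw [sum_insert hi, prod_insert hi, AddChar.map_add_eq_mul, ih]

/-- A Galois extension of odd degree has square discriminant: the determinant of the matrix of
conjugates of a basis is fixed by the Galois group, because left multiplication by an element of a
group of odd order is an even permutation. -/
theorem isSquare_discr_of_odd_finrank {K L ι : Type*} [Field K] [Field L] [Algebra K L]
    [FiniteDimensional K L] [IsGalois K L] [Fintype ι] [DecidableEq ι]
    (hodd : Odd (Module.finrank K L)) (b : Module.Basis ι K L) :
    IsSquare (Algebra.discr K b) := by
  classical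
  have hcard : Fintype.card Gal(L/K) = Fintype.card ι := by
    rw [← Module.finrank_eq_card_basis b, ← IsGalois.card_aut_eq_finrank K L,
      Nat.card_eq_fintype_card]
  let e : Gal(L/K) ≃ ι := Fintype.equivOfCardEq hcard
  let A : Matrix Gal(L/K) Gal(L/K) L := Matrix.of fun g j => g (b (e j))
  have hA : algebraMap K L (Algebra.discr K b) = A.det ^ 2 := by
    rw [← Algebra.discr_reindex K b e.symm, Algebra.discr_def, RingHom.map_det, sq]
    conv_rhs => enter [1]; rw [← Matrix.det_transpose]
    rw [← Matrix.det_mul]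
    congr 1
    ext i j
    simp [A, Matrix.mul_apply, Algebra.traceMatrix_apply, Algebra.traceForm_apply,
      trace_eq_sum_automorphisms]
  have hfix : ∀ σ : Gal(L/K), σ A.det = A.det := by
    intro σ
    let π : Equiv.Perm Gal(L/K) := MulAction.toPermHom Gal(L/K) Gal(L/K) σ
    have hsign : Equiv.Perm.sign π = 1 := by
      have h1 : π ^ Fintype.card Gal(L/K) = 1 := by
        rw [← map_pow, pow_card_eq_one, map_one]
      have h2 := congrArg Equiv.Perm.sign h1
      rw [map_pow, map_one, hcard, ← Module.finrank_eq_card_basis b] at h2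
      rcases Int.units_eq_one_or (Equiv.Perm.sign π) with h | h
      · exact h
      · rw [h, hodd.neg_one_pow] at h2
        exact absurd h2 (by decide)
    have h3 : σ A.det = (A.submatrix π id).det := by
      rw [AlgEquiv.map_det]
      rfl
    rw [h3, Matrix.det_permute, hsign]
    simp
  obtain ⟨c, hc⟩ := IntermediateField.mem_bot.1 ((IsGalois.mem_bot_iff_fixed A.det).2 hfix)
  refine ⟨c, (algebraMap K L).injective ?_⟩
  rw [hA, map_mul, hc, sq]

variable {K : Type*} [Field K] [Fintype K] [DecidableEq K] {ψ : AddChar K ℂ}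
  {F : Type*} [Field F] [Fintype F] [Algebra K F]

/-- In odd degree the trace form `Tr(x²)` is diagonalizable with coefficients whose product is a
nonzero square. -/
theorem exists_trace_sq_eq_sum (hK : ringChar K ≠ 2) (hodd : Odd (Module.finrank K F)) :
    ∃ (v : (Fin (Module.finrank K F) → K) ≃ F) (w : Fin (Module.finrank K F) → K),
      (∀ i, w i ≠ 0) ∧ ∏ i, quadraticChar K (w i) = 1 ∧
      ∀ c, Algebra.trace K F (v c ^ 2) = ∑ i, w i * c i ^ 2 := by
  let _ : Invertible (2 : K) := invertibleOfNonzero (Ring.two_ne_zero hK)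
  obtain ⟨v, hv⟩ := LinearMap.BilinForm.exists_orthogonal_basis
    (LinearMap.BilinForm.isSymm_iff.1 (Algebra.traceForm_isSymm (S := F) K))
  have hv' : ∀ i j, i ≠ j → Algebra.trace K F (v i * v j) = 0 := fun i j hij => hv hij
  have hdisc : Algebra.discr K v = ∏ i, Algebra.trace K F (v i * v i) := by
    rw [Algebra.discr_def, ← Matrix.det_diagonal]
    congr 1
    ext i j
    rw [Algebra.traceMatrix_apply, Algebra.traceForm_apply, Matrix.diagonal_apply]
    split_ifs with h
    · rw [h]
    · exact hv' i j h
  have hprod : ∏ i, Algebra.trace K F (v i * v i) ≠ 0 :=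
    hdisc ▸ Algebra.discr_not_zero_of_basis K v
  refine ⟨v.equivFun.symm.toEquiv, fun i => Algebra.trace K F (v i * v i),
    fun i => prod_ne_zero_iff.1 hprod i (mem_univ i), ?_, fun c => ?_⟩
  · rw [← map_prod, quadraticChar_one_iff_isSquare hprod, ← hdisc]
    exact isSquare_discr_of_odd_finrank hodd v
  · rw [LinearEquiv.coe_toEquiv, Module.Basis.equivFun_symm_apply, sq, sum_mul_sum, map_sum]
    refine sum_congr rfl fun i _ => ?_
    rw [map_sum, sum_eq_single i]
    · rw [smul_mul_smul_comm, map_smul, smul_eq_mul]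
      ring
    · intro j _ hj
      rw [smul_mul_smul_comm, map_smul, hv' i j hj.symm, smul_zero]
    · simp

/-- The quadratic case of the Hasse-Davenport relation, in odd degree. -/
theorem sum_addChar_mul_trace_sq (hK : ringChar K ≠ 2) (hψ : ψ.IsPrimitive)
    (hodd : Odd (Module.finrank K F)) {a : K} (ha : a ≠ 0) :
    ∑ x : F, ψ (a * Algebra.trace K F (x ^ 2)) =
      quadraticChar K a * quadGaussSum ψ ^ Module.finrank K F := by
  obtain ⟨v, w, hw, hχ, hv⟩ := exists_trace_sq_eq_sum (F := F) hK hodd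
  generalize Module.finrank K F = m at *
  rw [← Equiv.sum_comp v]
  calc ∑ c : Fin m → K, ψ (a * Algebra.trace K F (v c ^ 2))
      = ∑ c : Fin m → K, ∏ i, ψ (a * w i * c i ^ 2) := by
        refine sum_congr rfl fun c _ => ?_
        rw [hv, mul_sum, AddChar.map_sum_eq_prod]
        simp only [mul_assoc]
    _ = ∏ i, ∑ x : K, ψ (a * w i * x ^ 2) := 
        (Fintype.prod_sum fun i x => ψ (a * w i * x ^ 2)).symm
    _ = ∏ i : Fin m, ((quadraticChar K a : ℂ) * quadraticChar K (w i) * quadGaussSum ψ) := by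
        refine prod_congr rfl fun i _ => ?_
        rw [sum_addChar_mul_sq hK hψ (mul_ne_zero ha (hw i)), map_mul, Int.cast_mul]
    _ = (quadraticChar K a : ℂ) ^ m * ((∏ i, quadraticChar K (w i) : ℤ) : ℂ) *
          quadGaussSum ψ ^ m := by
        rw [prod_mul_distrib, prod_mul_distrib, prod_const, prod_const, card_univ,
          Fintype.card_fin, Int.cast_prod]
    _ = _ := by
        rw [hχ, Int.cast_one, mul_one]
        congr 1
        rcases quadraticChar_dichotomy ha with h | h
        · simp [h]
        · rw [h]
          push_cast
          exact hodd.neg_one_pow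

end TraceForm

/-! ### The form `Tr(x^(q+1))` -/

section FrobeniusForm

open QuadraticMap

/-- The quadratic form `x ↦ Tr(x · x^q)` on a finite field `F` over its subfield `K` with `q`
elements. -/
noncomputable def frobeniusForm (K F : Type*) [Field K] [Fintype K] [Field F] [Algebra K F] :
    QuadraticForm K F :=
  LinearMap.BilinMap.toQuadraticMap
    ((Algebra.traceForm K F).compl₂ (FiniteField.frobeniusAlgHom K F).toLinearMap)

variable {K : Type*} [Field K] [Fintype K] {F : Type*} [Field F] [Algebra K F]

theorem frobeniusForm_apply (x : F) :
    frobeniusForm K F x = Algebra.trace K F (x ^ (Fintype.card K + 1)) := by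
  rw [pow_succ']
  rfl

theorem polar_frobeniusForm (x y : F) :
    polar (frobeniusForm K F) x y =
      Algebra.trace K F (x * y ^ Fintype.card K + y * x ^ Fintype.card K) := by
  rw [frobeniusForm, LinearMap.BilinMap.polar_toQuadraticMap, map_add]
  rfl

variable [Fintype F]

theorem trace_pow_card (x : F) :
    Algebra.trace K F (x ^ Fintype.card K) = Algebra.trace K F x :=
  Algebra.trace_eq_of_algEquiv (FiniteField.frobeniusAlgEquivOfAlgebraic K F) x

theorem polar_frobeniusForm_half (hK : ringChar K ≠ 2) (y : F) :
    polar (frobeniusForm K F) (algebraMap K F 2⁻¹) y = Algebra.trace K F y := by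
  have h2 : (2 : K) ≠ 0 := Ring.two_ne_zero hK
  rw [polar_frobeniusForm, ← map_pow, FiniteField.pow_card, mul_comm y, ← Algebra.smul_def,
    ← Algebra.smul_def, map_add, map_smul, map_smul, trace_pow_card, ← two_mul, smul_eq_mul,
    mul_inv_cancel_left₀ h2]

/-- The form is nondegenerate in odd degree: an element `z` of the radical satisfies
`z^(q²) = -z`, and iterating this over the odd degree gives `z = -z`. -/
theorem exists_polar_frobeniusForm_ne_zero (hK : ringChar K ≠ 2)
    (hodd : Odd (Module.finrank K F)) {z : F} (hz : z ≠ 0) :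
    ∃ y, polar (frobeniusForm K F) z y ≠ 0 := by
  by_contra! h
  set q := Fintype.card K with hq
  let φ := FiniteField.frobeniusAlgEquivOfAlgebraic K F
  have hφ : ∀ x, φ x = x ^ q := fun x => rfl
  have hz2 : (φ ^ 2) z = -z := by
    have h1 : ∀ w, Algebra.traceForm K F (φ (φ z) + z) w = 0 := by
      intro w
      obtain ⟨y, rfl⟩ := φ.surjective w
      rw [Algebra.traceForm_apply, add_mul, ← map_mul, map_add, hφ (_ * _), trace_pow_card,
        ← map_add, ← h y, polar_frobeniusForm, hφ, hφ, add_comm, mul_comm y]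
    have h2 := (traceForm_nondegenerate K F).1 _ h1
    exact eq_neg_of_add_eq_zero_left h2
  have hiter : ∀ n, (φ ^ (2 * n)) z = (-1) ^ n * z := by
    intro n
    induction n with
    | zero => simp
    | succ n ih =>
      rw [mul_add, mul_one, pow_add, AlgEquiv.mul_apply, hz2, map_neg, ih]
      ring
  have h1 : φ ^ Module.finrank K F = 1 := by
    rw [← FiniteField.orderOf_frobeniusAlgEquivOfAlgebraic K F]
    exact pow_orderOf_eq_one _
  have h3 := hiter (Module.finrank K F)
  rw [mul_comm 2, pow_mul, h1, one_pow, AlgEquiv.one_apply, hodd.neg_one_pow] at h3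
  have h2 : (2 : F) ≠ 0 := by
    rw [← map_ofNat (algebraMap K F) 2]
    exact (map_ne_zero _).2 (Ring.two_ne_zero hK)
  refine hz ((mul_eq_zero.1 ?_).resolve_left h2)
  linear_combination h3

/-- In odd degree `x^(q+1)` and `x²` take every value equally often: up to a multiple of the order
of the unit group, `q + 1` is twice a number prime to this order. -/
theorem exists_bijective_pow_sq_eq (hK : ringChar K ≠ 2) (hodd : Odd (Module.finrank K F)) :
    ∃ k : ℕ, Function.Bijective (fun x : F => x ^ k) ∧
      ∀ x : F, (x ^ k) ^ 2 = x ^ (Fintype.card K + 1) := by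
  set q := Fintype.card K with hq
  have hqodd : q % 2 = 1 := FiniteField.odd_card_of_char_ne_two hK
  have hcard : Fintype.card F = q ^ Module.finrank K F := Module.card_eq_pow_finrank
  set m := Module.finrank K F
  set N := Fintype.card F - 1 with hN
  have hN1 : N + 1 = q ^ m := by
    have := Fintype.card_pos (α := F)
    omega
  -- `N / 2` is odd in the case where `(q + 1) / 2` is even
  obtain ⟨k, hk, hk2⟩ : ∃ k, Odd k ∧ (2 * k = q + 1 ∨ 2 * k = q + 1 + N) := by
    have h4 : q % 4 = 1 ∨ q % 4 = 3 := by omega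
    rcases h4 with h4 | h4
    · exact ⟨(q + 1) / 2, Nat.odd_iff.2 (by omega), Or.inl (by omega)⟩
    · have h5 : q ^ m % 4 = 3 := by
        obtain ⟨j, hj⟩ := hodd
        rw [hj, pow_succ, pow_mul, Nat.mul_mod, Nat.pow_mod, Nat.pow_mod q, h4]
        simp
      exact ⟨(q + 1 + N) / 2, Nat.odd_iff.2 (by omega), Or.inr (by omega)⟩
  have hcop : (Nat.card Fˣ).Coprime k := by
    rw [Nat.card_units, Nat.card_eq_fintype_card, ← hN]
    refine Nat.coprime_of_dvd fun r hr hrN hrk => ?_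
    have := Fact.mk hr
    have hq1 : (q : ZMod r) = -1 := by
      have h1 : r ∣ q + 1 := by
        have h2 : r ∣ 2 * k := hrk.mul_left 2
        rcases hk2 with h | h
        · rwa [h] at h2
        · rw [h] at h2
          exact (Nat.dvd_add_left hrN).1 h2
      have h3 := (ZMod.natCast_eq_zero_iff _ _).2 h1
      push_cast at h3
      exact eq_neg_of_add_eq_zero_left h3
    have h3 := congrArg (Nat.cast : ℕ → ZMod r) hN1
    push_cast at h3
    rw [hq1, (ZMod.natCast_eq_zero_iff _ _).2 hrN, hodd.neg_one_pow] at h3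
    have h4 : ((2 : ℕ) : ZMod r) = 0 := by
      push_cast
      linear_combination h3
    have h5 := (Nat.prime_dvd_prime_iff_eq hr Nat.prime_two).1 ((ZMod.natCast_eq_zero_iff _ _).1 h4)
    rw [h5] at hrk
    exact (Nat.not_even_iff_odd.2 hk) (even_iff_two_dvd.2 hrk)
  have hk0 : k ≠ 0 := by
    rintro rfl
    exact absurd hk (by decide)
  refine ⟨k, Finite.injective_iff_bijective.1 fun x y hxy => ?_, fun x => ?_⟩
  · rcases eq_or_ne x 0 with rfl | hx
    · rw [zero_pow hk0] at hxy
      exact (eq_zero_of_pow_eq_zero hxy.symm).symm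
    · have hy : y ≠ 0 := by
        rintro rfl
        rw [zero_pow hk0] at hxy
        exact hx (eq_zero_of_pow_eq_zero hxy)
      have := hcop.pow_left_bijective.1 (a₁ := Units.mk0 x hx) (a₂ := Units.mk0 y hy)
        (Units.ext (by simpa using hxy))
      simpa using congrArg Units.val this
  · rw [← pow_mul, mul_comm k]
    rcases hk2 with h | h
    · rw [h]
    · rw [h]
      rcases eq_or_ne x 0 with rfl | hx
      · rw [zero_pow (by omega), zero_pow (by omega)]
      · rw [pow_add, FiniteField.pow_card_sub_one_eq_one x hx, mul_one]

theorem hasGaussFactor_frobeniusForm [DecidableEq K] {ψ : AddChar K ℂ} (hK : ringChar K ≠ 2)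
    (hψ : ψ.IsPrimitive) (hodd : Odd (Module.finrank K F)) :
    HasGaussFactor ψ (frobeniusForm K F)
      (((quadraticChar K (-1) : ℂ) * Fintype.card K) ^ ((Module.finrank K F - 1) / 2)) := by
  intro a ha
  obtain ⟨k, hk, hk2⟩ := exists_bijective_pow_sq_eq hK hodd
  have h := sum_addChar_mul_trace_sq hK hψ hodd ha
  rw [← (Equiv.ofBijective _ hk).sum_comp] at h
  simp only [Equiv.ofBijective_apply, hk2, ← frobeniusForm_apply] at h
  rw [h, ← quadGaussSum_sq hK hψ, ← pow_mul, ← pow_succ]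
  obtain ⟨j, hj⟩ := hodd
  congr 2
  omega

end FrobeniusForm

/-! ### Counts over the prime field -/

section PrimeField

open QuadraticMap

variable {p : ℕ} [Fact p.Prime] {F : Type*} [Field F] [Fintype F] [Algebra (ZMod p) F] {k : ℕ}

theorem ringChar_zmod_ne_two (hp : p ≠ 2) : ringChar (ZMod p) ≠ 2 := by
  rwa [ZMod.ringChar_zmod_n]

/-- The odd degree `m ≥ 3` is written `2 k + 3` from here on, so that `(m - 1) / 2 = k + 1` and
`(m - 3) / 2 = k`. -/
theorem quadraticChar_neg_one_pow_eq_codeSign (hp : p ≠ 2) :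
    quadraticChar (ZMod p) (-1) ^ (k + 1) = codeSign p (2 * k + 3) := by
  have hodd := (Fact.out : p.Prime).eq_two_or_odd.resolve_left hp
  rw [quadraticChar_neg_one (ringChar_zmod_ne_two hp), ZMod.card, ZMod.χ₄_eq_neg_one_pow hodd,
    codeSign, ← pow_mul]
  congr 2 <;> omega

theorem hasGaussFactor_frobeniusForm_zmod (hp : p ≠ 2)
    (hF : Module.finrank (ZMod p) F = 2 * k + 3) :
    HasGaussFactor ZMod.stdAddChar (frobeniusForm (ZMod p) F)
      ((codeSign p (2 * k + 3) : ℂ) * p ^ (k + 1)) := by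
  have h := hasGaussFactor_frobeniusForm (F := F) (ringChar_zmod_ne_two hp)
    (ZMod.isPrimitive_stdAddChar p) (by rw [hF]; exact ⟨k + 1, by ring⟩)
  rw [hF, show (2 * k + 3 - 1) / 2 = k + 1 by omega, mul_pow, ZMod.card, ← Int.cast_pow,
    quadraticChar_neg_one_pow_eq_codeSign hp] at h
  exact h

theorem card_eq_pow_of_finrank (hF : Module.finrank (ZMod p) F = 2 * k + 3) :
    Fintype.card F = p ^ (2 * k + 3) := by
  rw [Module.card_eq_pow_finrank (K := ZMod p), hF, ZMod.card]

theorem card_frobeniusForm_eq (hp : p ≠ 2) (hF : Module.finrank (ZMod p) F = 2 * k + 3)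
    (s : ZMod p) :
    (#{y : F | frobeniusForm (ZMod p) F y = s} : ℤ) =
      p ^ (2 * k + 2) + codeSign p (2 * k + 3) * quadraticChar (ZMod p) s * p ^ (k + 1) := by
  have h := (hasGaussFactor_frobeniusForm_zmod (F := F) hp hF).card_eq (ringChar_zmod_ne_two hp)
    (ZMod.isPrimitive_stdAddChar p) s
  rw [ZMod.card, card_eq_pow_of_finrank hF] at h
  have hp0 : (p : ℂ) ≠ 0 := by exact_mod_cast (Fact.out : p.Prime).ne_zero
  have h2 : (#{y : F | frobeniusForm (ZMod p) F y = s} : ℂ) =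
      p ^ (2 * k + 2) + codeSign p (2 * k + 3) * quadraticChar (ZMod p) s * p ^ (k + 1) := by
    refine mul_left_cancel₀ hp0 (h.trans ?_)
    push_cast
    ring
  exact_mod_cast h2

theorem card_frobeniusForm_inter_of_isotropic (hp : p ≠ 2)
    (hF : Module.finrank (ZMod p) F = 2 * k + 3) {z : F} (hz : z ≠ 0)
    (h0 : frobeniusForm (ZMod p) F z = 0) (s t : ZMod p) :
    (#{y | frobeniusForm (ZMod p) F y = s ∧ polar (frobeniusForm (ZMod p) F) z y = t} : ℤ) =
      p ^ (2 * k + 1) + if t = 0 then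
        codeSign p (2 * k + 3) * quadraticChar (ZMod p) s * p ^ (k + 1) else 0 := by
  have hK := ringChar_zmod_ne_two hp
  have h := (hasGaussFactor_frobeniusForm_zmod hp hF).card_inter_hyperplane_of_isotropic hK
    (ZMod.isPrimitive_stdAddChar p)
    (exists_polar_frobeniusForm_ne_zero hK (by rw [hF]; exact ⟨k + 1, by ring⟩) hz) h0 s t
  rw [ZMod.card, card_eq_pow_of_finrank hF] at h
  have hp0 : (p : ℂ) ^ 2 ≠ 0 := pow_ne_zero _ (by exact_mod_cast (Fact.out : p.Prime).ne_zero)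
  have h2 : (#{y | frobeniusForm (ZMod p) F y = s ∧
      polar (frobeniusForm (ZMod p) F) z y = t} : ℂ) =
      p ^ (2 * k + 1) + if t = 0 then
        (codeSign p (2 * k + 3) : ℂ) * quadraticChar (ZMod p) s * p ^ (k + 1) else 0 := by
    refine mul_left_cancel₀ hp0 (h.trans ?_)
    push_cast
    split_ifs <;> ring
  exact_mod_cast h2

theorem card_frobeniusForm_inter_of_anisotropic (hp : p ≠ 2)
    (hF : Module.finrank (ZMod p) F = 2 * k + 3) {z : F}
    (h0 : frobeniusForm (ZMod p) F z ≠ 0) (s t : ZMod p) :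
    (#{y | frobeniusForm (ZMod p) F y = s ∧ polar (frobeniusForm (ZMod p) F) z y = t} : ℤ) =
      p ^ (2 * k + 1) +
        codeSign p (2 * k + 3) * quadraticChar (ZMod p) (frobeniusForm (ZMod p) F z) * p ^ k *
          ((if t ^ 2 = 4 * frobeniusForm (ZMod p) F z * s then (p : ℤ) else 0) - 1) := by
  have hK := ringChar_zmod_ne_two hp
  have hz : z ≠ 0 := by
    rintro rfl
    exact h0 (QuadraticMap.map_zero _)
  have h := (hasGaussFactor_frobeniusForm_zmod hp hF).card_inter_hyperplane_of_anisotropic hK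
    (ZMod.isPrimitive_stdAddChar p)
    (exists_polar_frobeniusForm_ne_zero hK (by rw [hF]; exact ⟨k + 1, by ring⟩) hz) h0 s t
  rw [ZMod.card, card_eq_pow_of_finrank hF] at h
  have hp0 : (p : ℂ) ^ 2 ≠ 0 := pow_ne_zero _ (by exact_mod_cast (Fact.out : p.Prime).ne_zero)
  have h2 : (#{y | frobeniusForm (ZMod p) F y = s ∧
      polar (frobeniusForm (ZMod p) F) z y = t} : ℂ) =
      p ^ (2 * k + 1) + (codeSign p (2 * k + 3) : ℂ) *
        quadraticChar (ZMod p) (frobeniusForm (ZMod p) F z) * p ^ k *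
          ((if t ^ 2 = 4 * frobeniusForm (ZMod p) F z * s then (p : ℂ) else 0) - 1) := by
    refine mul_left_cancel₀ hp0 (h.trans ?_)
    push_cast
    ring
  exact_mod_cast h2

theorem four_ne_zero_zmod (hp : p ≠ 2) : (4 : ZMod p) ≠ 0 := by
  have h : (4 : ZMod p) = 2 * 2 := by norm_num
  rw [h]
  exact mul_self_ne_zero.2 (Ring.two_ne_zero (ringChar_zmod_ne_two hp))

theorem quadraticChar_four (hp : p ≠ 2) : quadraticChar (ZMod p) 4 = 1 := by
  have h : (4 : ZMod p) = 2 ^ 2 := by norm_num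
  rw [h]
  exact quadraticChar_sq_one' (Ring.two_ne_zero (ringChar_zmod_ne_two hp))

theorem quadraticChar_div_four (hp : p ≠ 2) (a : ZMod p) :
    quadraticChar (ZMod p) (a / 4) = quadraticChar (ZMod p) a := by
  have h : a / 4 * 4 = a := div_mul_cancel₀ _ (four_ne_zero_zmod hp)
  conv_rhs => rw [← h, map_mul, quadraticChar_four hp, mul_one]

theorem frobeniusForm_half (hp : p ≠ 2) :
    frobeniusForm (ZMod p) F (algebraMap (ZMod p) F 2⁻¹) =
      (Module.finrank (ZMod p) F : ZMod p) / 4 := by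
  have h2 : (2 : ZMod p) ≠ 0 := Ring.two_ne_zero (ringChar_zmod_ne_two hp)
  rw [frobeniusForm_apply, pow_succ, ← map_pow, FiniteField.pow_card, ← map_mul,
    Algebra.trace_algebraMap, nsmul_eq_mul, div_eq_mul_inv]
  congr 1
  rw [← mul_inv]
  norm_num

/-- The joint distribution of `Tr(z^(p+1))` and `Tr(z)` when `p` divides the degree. -/
theorem card_frobeniusForm_trace_of_eq_zero (hp : p ≠ 2)
    (hF : Module.finrank (ZMod p) F = 2 * k + 3) (hm : ((2 * k + 3 : ℕ) : ZMod p) = 0)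
    (r t : ZMod p) :
    (#{z | frobeniusForm (ZMod p) F z = r ∧ Algebra.trace (ZMod p) F z = t} : ℤ) =
      p ^ (2 * k + 1) + if t = 0 then
        codeSign p (2 * k + 3) * quadraticChar (ZMod p) r * p ^ (k + 1) else 0 := by
  have hK := ringChar_zmod_ne_two hp
  rw [← card_frobeniusForm_inter_of_isotropic hp hF (z := algebraMap (ZMod p) F 2⁻¹)]
  · simp only [polar_frobeniusForm_half hK]
  · exact (map_ne_zero _).2 (inv_ne_zero (Ring.two_ne_zero hK))
  · rw [frobeniusForm_half hp, hF, hm, zero_div]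

/-- The joint distribution of `Tr(z^(p+1))` and `Tr(z)` when `p` does not divide the degree. -/
theorem card_frobeniusForm_trace_of_ne_zero (hp : p ≠ 2)
    (hF : Module.finrank (ZMod p) F = 2 * k + 3) (hm : ((2 * k + 3 : ℕ) : ZMod p) ≠ 0)
    (r t : ZMod p) :
    (#{z | frobeniusForm (ZMod p) F z = r ∧ Algebra.trace (ZMod p) F z = t} : ℤ) =
      p ^ (2 * k + 1) +
        quadraticChar (ZMod p) ((2 * k + 3 : ℕ) : ZMod p) * codeSign p (2 * k + 3) * p ^ k *
          ((if t ^ 2 = ((2 * k + 3 : ℕ) : ZMod p) * r then (p : ℤ) else 0) - 1) := by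
  have hK := ringChar_zmod_ne_two hp
  have h4 := four_ne_zero_zmod hp
  have he := frobeniusForm_half (F := F) hp
  rw [hF] at he
  have h := card_frobeniusForm_inter_of_anisotropic hp hF (z := algebraMap (ZMod p) F 2⁻¹)
    (by rw [he]; exact div_ne_zero hm h4) r t
  rw [he, quadraticChar_div_four hp, mul_div_cancel₀ _ h4] at h
  simp only [polar_frobeniusForm_half hK] at h
  rw [h]
  ring

/-- The translate `x = 1/2 - y` turns the equation of the defining set into that of a quadric. -/
theorem frobeniusForm_half_sub (hp : p ≠ 2) (y : F) :
    frobeniusForm (ZMod p) F (algebraMap (ZMod p) F 2⁻¹ - y) -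
        Algebra.trace (ZMod p) F (algebraMap (ZMod p) F 2⁻¹ - y) =
      frobeniusForm (ZMod p) F y - (Module.finrank (ZMod p) F : ZMod p) / 4 := by
  have hK := ringChar_zmod_ne_two hp
  have h2 : (2 : ZMod p) ≠ 0 := Ring.two_ne_zero hK
  have h4 := four_ne_zero_zmod hp
  have h := polar_frobeniusForm_half (F := F) hK (-y)
  rw [polar, ← sub_eq_add_neg, QuadraticMap.map_neg, frobeniusForm_half hp, map_neg] at h
  rw [map_sub (Algebra.trace (ZMod p) F), Algebra.trace_algebraMap, nsmul_eq_mul]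
  have h5 : (2⁻¹ : ZMod p) = 4⁻¹ + 4⁻¹ := by
    rw [← two_mul, eq_mul_inv_iff_mul_eq₀ h4, show (4 : ZMod p) = 2 * 2 by norm_num,
      inv_mul_cancel_left₀ h2]
  linear_combination h - (Module.finrank (ZMod p) F : ZMod p) * h5

end PrimeField

/-! ### Weights of the codewords -/

section Weights

open QuadraticMap

variable {p : ℕ} [Fact p.Prime] {F : Type*} [Field F] [Fintype F] [Algebra (ZMod p) F] {k n : ℕ}
  {d : Fin n → F}

/-- The codeword `(Tr(b d_1), …, Tr(b d_n))` of the trace code. -/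
noncomputable def traceCodeword (p : ℕ) {F : Type*} [Field F] [Algebra (ZMod p) F] {n : ℕ}
    (d : Fin n → F) : F →ₗ[ZMod p] (Fin n → ZMod p) :=
  LinearMap.pi fun i => Algebra.trace (ZMod p) F ∘ₗ LinearMap.mulRight (ZMod p) (d i)

/-- `D` is the solution set of `Tr(x^(p+1)) = Tr(x)` without the solution `0`, which accounts for
the extra `1` when only the solutions with a property of `0` are counted. -/
theorem card_index_filter (hd : Function.Injective d) (hD : Set.range d = definingSet p F)
    (P : F → Prop) [DecidablePred P] (h0 : P 0) :
    #{i | P (d i)} + 1 =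
      #{x | frobeniusForm (ZMod p) F x = Algebra.trace (ZMod p) F x ∧ P x} := by
  classical
  have h : ({x | frobeniusForm (ZMod p) F x = Algebra.trace (ZMod p) F x ∧ P x} : Finset F) =
      insert 0 (({i | P (d i)} : Finset (Fin n)).image d) := by
    ext x
    have hx : x ∈ Set.range d ↔ x ∈ definingSet p F := by rw [hD]
    simp only [definingSet, Set.mem_range, Set.mem_ofPred_eq, map_sub, sub_eq_zero] at hx
    simp only [mem_filter, mem_univ, true_and, mem_insert, mem_image, frobeniusForm_apply,
      ZMod.card]
    constructor
    · rintro ⟨h1, h2⟩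
      by_cases h3 : x = 0
      · exact Or.inl h3
      · obtain ⟨i, rfl⟩ := hx.2 ⟨h3, h1⟩
        exact Or.inr ⟨i, h2, rfl⟩
    · rintro (rfl | ⟨i, hi, rfl⟩)
      · simp [h0]
      · exact ⟨(hx.1 ⟨i, rfl⟩).2, hi⟩
  rw [h, card_insert_of_notMem, card_image_of_injective _ hd]
  rw [mem_image]
  rintro ⟨i, -, hi⟩
  have : d i ∈ definingSet p F := hD ▸ ⟨i, rfl⟩
  exact this.1 hi

theorem card_frobeniusForm_eq_trace (hp : p ≠ 2) (P : F → Prop) [DecidablePred P] :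
    #{x | frobeniusForm (ZMod p) F x = Algebra.trace (ZMod p) F x ∧ P x} =
      #{y | frobeniusForm (ZMod p) F y = (Module.finrank (ZMod p) F : ZMod p) / 4 ∧
        P (algebraMap (ZMod p) F 2⁻¹ - y)} := by
  refine card_equiv (Equiv.subLeft (algebraMap (ZMod p) F 2⁻¹)) fun x => ?_
  have h := frobeniusForm_half_sub hp (algebraMap (ZMod p) F 2⁻¹ - x)
  rw [sub_sub_cancel] at h
  simp only [mem_filter, mem_univ, true_and, Equiv.subLeft_apply, sub_sub_cancel]
  rw [← sub_eq_zero, h, sub_eq_zero]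

theorem length_eq (hp : p ≠ 2) (hF : Module.finrank (ZMod p) F = 2 * k + 3)
    (hd : Function.Injective d) (hD : Set.range d = definingSet p F) :
    (n : ℤ) = p ^ (2 * k + 2) - 1 + codeSign p (2 * k + 3) *
      quadraticChar (ZMod p) ((2 * k + 3 : ℕ) : ZMod p) * p ^ (k + 1) := by
  have h1 := card_index_filter hd hD (fun _ => True) trivial
  rw [card_frobeniusForm_eq_trace hp] at h1
  simp only [and_true, filter_true, card_univ, Fintype.card_fin] at h1
  have h2 := card_frobeniusForm_eq hp hF (((2 * k + 3 : ℕ) : ZMod p) / 4)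
  rw [← hF, ← h1, quadraticChar_div_four hp, hF] at h2
  push_cast at h2 ⊢
  linear_combination h2

/-- The polar form and the trace form are nondegenerate, so every `Tr(b · )` is `P(z, · )` for a
unique `z`. -/
theorem exists_equiv_trace_mul_eq_polar (hp : p ≠ 2) (hodd : Odd (Module.finrank (ZMod p) F)) :
    ∃ φ : F ≃ₗ[ZMod p] F, ∀ z y,
      Algebra.trace (ZMod p) F (φ z * y) = polar (frobeniusForm (ZMod p) F) z y := by
  let ψ : F →ₗ[ZMod p] Module.Dual (ZMod p) F := (frobeniusForm (ZMod p) F).polarBilin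
  have hψ : Function.Injective ψ := by
    refine (injective_iff_map_eq_zero ψ).2 fun z hz => ?_
    by_contra hne
    obtain ⟨y, hy⟩ := exists_polar_frobeniusForm_ne_zero (ringChar_zmod_ne_two hp) hodd hne
    exact hy (LinearMap.congr_fun hz y)
  let τ := (Algebra.traceForm (ZMod p) F).toDual (traceForm_nondegenerate (ZMod p) F)
  refine ⟨LinearEquiv.ofInjectiveEndo (τ.symm.toLinearMap ∘ₗ ψ) (τ.symm.injective.comp hψ),
    fun z y => ?_⟩
  have h : τ (τ.symm (ψ z)) y = ψ z y := by rw [LinearEquiv.apply_symm_apply]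
  exact h

/-- The weight of a codeword is the difference between the number of points of a quadric and that
of a hyperplane section of it. -/
theorem hammingNorm_traceCodeword (hp : p ≠ 2) (hF : Module.finrank (ZMod p) F = 2 * k + 3)
    (hd : Function.Injective d) (hD : Set.range d = definingSet p F) {z b : F}
    (hb : ∀ y, Algebra.trace (ZMod p) F (b * y) = polar (frobeniusForm (ZMod p) F) z y) :
    (hammingNorm (traceCodeword p d b) : ℤ) = p ^ (2 * k + 2) +
      codeSign p (2 * k + 3) * quadraticChar (ZMod p) ((2 * k + 3 : ℕ) : ZMod p) * p ^ (k + 1) -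
      #{y | frobeniusForm (ZMod p) F y = ((2 * k + 3 : ℕ) : ZMod p) / 4 ∧
        polar (frobeniusForm (ZMod p) F) z y = Algebra.trace (ZMod p) F z} := by
  have h1 := card_index_filter hd hD (fun x => Algebra.trace (ZMod p) F (b * x) = 0) (by simp)
  rw [card_frobeniusForm_eq_trace hp, hF] at h1
  have h2 : #{i | Algebra.trace (ZMod p) F (b * d i) = 0} +
      hammingNorm (traceCodeword p d b) = n := by
    have := card_filter_add_card_filter_not (s := (univ : Finset (Fin n)))
      (fun i => Algebra.trace (ZMod p) F (b * d i) = 0)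
    rwa [card_univ, Fintype.card_fin] at this
  have h3 := length_eq hp hF hd hD
  have h4 : ∀ y, Algebra.trace (ZMod p) F (b * (algebraMap (ZMod p) F 2⁻¹ - y)) = 0 ↔
      polar (frobeniusForm (ZMod p) F) z y = Algebra.trace (ZMod p) F z := by
    intro y
    rw [mul_sub, map_sub, hb, hb, sub_eq_zero, polar_comm,
      polar_frobeniusForm_half (ringChar_zmod_ne_two hp), eq_comm]
  simp only [h4] at h1
  replace h1 := congrArg (Nat.cast : ℕ → ℤ) h1
  rw [Nat.cast_add, Nat.cast_one] at h1
  zify at h2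
  linear_combination h3 - h1 + h2

/-- The weight of a codeword in the case where `p` divides the degree. -/
theorem hammingNorm_traceCodeword_of_eq_zero (hp : p ≠ 2)
    (hF : Module.finrank (ZMod p) F = 2 * k + 3) (hd : Function.Injective d)
    (hD : Set.range d = definingSet p F) (hm : ((2 * k + 3 : ℕ) : ZMod p) = 0) {z b : F}
    (hz : z ≠ 0)
    (hb : ∀ y, Algebra.trace (ZMod p) F (b * y) = polar (frobeniusForm (ZMod p) F) z y) :
    (hammingNorm (traceCodeword p d b) : ℤ) = (p - 1) * p ^ (2 * k + 1) +
      (if Algebra.trace (ZMod p) F z = 0 then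
          -(p - 1) * quadraticChar (ZMod p) (frobeniusForm (ZMod p) F z)
        else quadraticChar (ZMod p) (frobeniusForm (ZMod p) F z)) *
      (codeSign p (2 * k + 3) * p ^ k) := by
  rw [hammingNorm_traceCodeword hp hF hd hD hb, hm, zero_div]
  by_cases h0 : frobeniusForm (ZMod p) F z = 0
  · rw [card_frobeniusForm_inter_of_isotropic hp hF hz h0, h0]
    simp only [MulChar.map_zero]
    split_ifs <;> ring
  · rw [card_frobeniusForm_inter_of_anisotropic hp hF h0]
    simp only [MulChar.map_zero, mul_zero, pow_eq_zero_iff two_ne_zero]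
    split_ifs <;> ring

/-- The weight of a codeword in the case where `p` does not divide the degree. -/
theorem hammingNorm_traceCodeword_of_ne_zero (hp : p ≠ 2)
    (hF : Module.finrank (ZMod p) F = 2 * k + 3) (hd : Function.Injective d)
    (hD : Set.range d = definingSet p F) (hm : ((2 * k + 3 : ℕ) : ZMod p) ≠ 0) {z b : F}
    (hz : z ≠ 0)
    (hb : ∀ y, Algebra.trace (ZMod p) F (b * y) = polar (frobeniusForm (ZMod p) F) z y) :
    (hammingNorm (traceCodeword p d b) : ℤ) = (p - 1) * p ^ (2 * k + 1) +
      (if frobeniusForm (ZMod p) F z = 0 then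
          if Algebra.trace (ZMod p) F z = 0 then 0 else (p : ℤ)
        else if Algebra.trace (ZMod p) F z ^ 2 =
            ((2 * k + 3 : ℕ) : ZMod p) * frobeniusForm (ZMod p) F z then 1
        else p + quadraticChar (ZMod p)
          (((2 * k + 3 : ℕ) : ZMod p) * frobeniusForm (ZMod p) F z)) *
      (quadraticChar (ZMod p) ((2 * k + 3 : ℕ) : ZMod p) * codeSign p (2 * k + 3) * p ^ k) := by
  rw [hammingNorm_traceCodeword hp hF hd hD hb]
  generalize ((2 * k + 3 : ℕ) : ZMod p) = μ at *
  have h4 := four_ne_zero_zmod hp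
  have hμ2 := quadraticChar_sq_one hm
  by_cases h0 : frobeniusForm (ZMod p) F z = 0
  · rw [card_frobeniusForm_inter_of_isotropic hp hF hz h0, quadraticChar_div_four hp, if_pos h0]
    split_ifs <;> ring
  · rw [card_frobeniusForm_inter_of_anisotropic hp hF h0, if_neg h0,
      show 4 * frobeniusForm (ZMod p) F z * (μ / 4) = μ * frobeniusForm (ZMod p) F z by
        field_simp, map_mul]
    split_ifs with h
    · -- `η(Q(z)) = η(μ)` here, because `μ Q(z)` is a square
      have h5 : quadraticChar (ZMod p) μ * quadraticChar (ZMod p) (frobeniusForm (ZMod p) F z)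
          = 1 := by
        rw [← map_mul, ← h]
        refine quadraticChar_sq_one' fun ht => ?_
        rw [ht, zero_pow two_ne_zero] at h
        exact mul_ne_zero hm h0 h.symm
      have h6 : quadraticChar (ZMod p) (frobeniusForm (ZMod p) F z) =
          quadraticChar (ZMod p) μ := by
        linear_combination quadraticChar (ZMod p) μ * h5 -
          quadraticChar (ZMod p) (frobeniusForm (ZMod p) F z) * hμ2
      rw [h6]
      ring
    · linear_combination (-quadraticChar (ZMod p) (frobeniusForm (ZMod p) F z) *
        codeSign p (2 * k + 3) * p ^ k) * hμ2

end Weights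

/-! ### From a weight formula to the number of codewords -/

section WeightCounts

open QuadraticMap

variable {p : ℕ} [Fact p.Prime] {F : Type*} [Field F] [Algebra (ZMod p) F] {k n : ℕ}
  {d : Fin n → F} {φ : F ≃ₗ[ZMod p] F} {κ : ZMod p → ZMod p → ℤ} {W u : ℤ}

/-- The weights of the trace code are `0` and `W + κ(r, t) u`, where the pair `(r, t)` is
`(Tr(z^(p+1)), Tr(z))` for a parameter `z ≠ 0` that runs through the field. -/
def HasWeightFormula (d : Fin n → F) (φ : F ≃ₗ[ZMod p] F) (κ : ZMod p → ZMod p → ℤ)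
    (W u : ℤ) : Prop :=
  u ≠ 0 ∧ (∀ r t, 0 < W + κ r t * u) ∧
    ∀ z, z ≠ 0 → (hammingNorm (traceCodeword p d (φ z)) : ℤ) =
      W + κ (frobeniusForm (ZMod p) F z) (Algebra.trace (ZMod p) F z) * u

theorem HasWeightFormula.injective (h : HasWeightFormula d φ κ W u) :
    Function.Injective (traceCodeword p d) := by
  refine (injective_iff_map_eq_zero _).2 fun b hb => ?_
  obtain ⟨z, rfl⟩ := φ.surjective b
  by_contra hz
  have hz' : z ≠ 0 := fun h0 => hz (by rw [h0, map_zero])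
  have h1 := h.2.2 z hz'
  rw [hb, hammingNorm_zero] at h1
  exact (h.2.1 _ _).ne h1

theorem HasWeightFormula.finrank (h : HasWeightFormula d φ κ W u) :
    Module.finrank (ZMod p) (traceCode p d) = Module.finrank (ZMod p) F :=
  LinearMap.finrank_range_of_inj h.injective

variable [Fintype F]

theorem weightCount_traceCode (hT : Function.Injective (traceCodeword p d)) (φ : F ≃ₗ[ZMod p] F)
    (w : ℤ) :
    weightCount (traceCode p d) w = #{z | (hammingNorm (traceCodeword p d (φ z)) : ℤ) = w} := by
  classical
  rw [weightCount, ← card_image_of_injective _ (hT.comp φ.injective), ← Set.ncard_coe_finset]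
  congr 1
  ext c
  simp only [Set.mem_ofPred_eq, coe_image, Set.mem_image, coe_filter, mem_univ, true_and,
    Function.comp_apply]
  constructor
  · rintro ⟨⟨b, rfl⟩, hb⟩
    exact ⟨φ.symm b, by rwa [φ.apply_symm_apply], by rw [φ.apply_symm_apply]; rfl⟩
  · rintro ⟨z, hz, rfl⟩
    exact ⟨⟨φ z, rfl⟩, hz⟩

theorem HasWeightFormula.weightCount_zero (h : HasWeightFormula d φ κ W u) :
    weightCount (traceCode p d) 0 = 1 := by
  rw [weightCount_traceCode h.injective φ, card_eq_one]
  refine ⟨0, ?_⟩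
  ext z
  simp only [Nat.cast_eq_zero, hammingNorm_eq_zero, mem_filter, mem_univ, true_and, mem_singleton]
  rw [map_eq_zero_iff _ h.injective, map_eq_zero_iff _ φ.injective]

theorem HasWeightFormula.weightCount_eq_zero (h : HasWeightFormula d φ κ W u) {w : ℤ}
    (h0 : w ≠ 0) (hw : ∀ r t, w ≠ W + κ r t * u) : weightCount (traceCode p d) w = 0 := by
  rw [weightCount_traceCode h.injective φ, card_eq_zero, filter_eq_empty_iff]
  intro z _ hz
  rcases eq_or_ne z 0 with rfl | hz0
  · simp only [map_zero, hammingNorm_zero, Nat.cast_zero] at hz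
    exact h0 hz.symm
  · exact hw _ _ (hz.symm.trans (h.2.2 z hz0))

/-- The parameter `z = 0` belongs to the zero codeword, so it is taken out of the class
`κ(r, t) = c` when it lies there. -/
theorem HasWeightFormula.weightCount_add (h : HasWeightFormula d φ κ W u) {c : ℤ}
    (hc : 0 < W + c * u) :
    (weightCount (traceCode p d) (W + c * u) : ℤ) =
      (∑ r, ∑ t, if κ r t = c then
        (#{z | frobeniusForm (ZMod p) F z = r ∧ Algebra.trace (ZMod p) F z = t} : ℤ) else 0) -
      if κ 0 0 = c then 1 else 0 := by
  classical
  have hsum : (∑ r, ∑ t, if κ r t = c then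
      (#{z | frobeniusForm (ZMod p) F z = r ∧ Algebra.trace (ZMod p) F z = t} : ℤ) else 0) =
      #{z | κ (frobeniusForm (ZMod p) F z) (Algebra.trace (ZMod p) F z) = c} := by
    rw [card_eq_sum_card_fiberwise
      (f := fun z => (frobeniusForm (ZMod p) F z, Algebra.trace (ZMod p) F z))
      (t := univ) (by simp), ← univ_product_univ, sum_product]
    push_cast
    refine sum_congr rfl fun r _ => sum_congr rfl fun t _ => ?_
    rw [filter_filter]
    split_ifs with hκ
    · congr 2
      ext z
      simp only [mem_filter, mem_univ, true_and, Prod.mk.injEq]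
      constructor
      · rintro ⟨rfl, rfl⟩
        exact ⟨hκ, rfl, rfl⟩
      · exact And.right
    · rw [eq_comm, Nat.cast_eq_zero, card_eq_zero, filter_eq_empty_iff]
      rintro z - ⟨h1, h2⟩
      simp only [Prod.mk.injEq] at h2
      exact hκ (h2.1 ▸ h2.2 ▸ h1)
  have hmem : ∀ z, (hammingNorm (traceCodeword p d (φ z)) : ℤ) = W + c * u ↔
      κ (frobeniusForm (ZMod p) F z) (Algebra.trace (ZMod p) F z) = c ∧ z ≠ 0 := by
    intro z
    rcases eq_or_ne z 0 with rfl | hz0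
    · simp only [map_zero, hammingNorm_zero, Nat.cast_zero, ne_eq, not_true_eq_false, and_false,
        iff_false]
      exact hc.ne
    · rw [h.2.2 z hz0, add_right_inj, mul_left_inj' h.1]
      simp [hz0]
  rw [hsum, weightCount_traceCode h.injective φ]
  simp only [hmem, ← filter_filter, filter_ne']
  split_ifs with h0
  · rw [card_erase_of_mem (by simp [h0]), Nat.cast_sub, Nat.cast_one]
    exact card_pos.2 ⟨0, by simp [h0]⟩
  · rw [erase_eq_of_notMem (by simp [h0]), sub_zero]

/-- Nonzero codewords have positive weight: the coefficient of the deviation is at most `p + 1`,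
which is less than `p (p - 1)` as `p ≥ 3`. -/
theorem weight_pos (hp : p ≠ 2) {c ε : ℤ} (hε : ε ^ 2 = 1) (hc : |c| ≤ p + 1) :
    0 < ((p : ℤ) - 1) * p ^ (2 * k + 1) + c * (ε * p ^ k) := by
  have hp3 : (3 : ℤ) ≤ p := by
    have h1 := (Fact.out : p.Prime).two_le
    have : 3 ≤ p := by omega
    exact_mod_cast this
  have hpk : (1 : ℤ) ≤ p ^ k := one_le_pow₀ (by linarith)
  have hε' : |ε| = 1 := by
    rcases sq_eq_one_iff.1 hε with rfl | rfl <;> simp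
  have h1 : |c * (ε * p ^ k)| ≤ (p + 1) * p ^ k := by
    rw [abs_mul, abs_mul, hε', one_mul, abs_of_pos (show (0 : ℤ) < p ^ k by linarith)]
    exact mul_le_mul_of_nonneg_right hc (by linarith)
  have h2 := (abs_le.1 h1).1
  rw [show ((p : ℤ) - 1) * p ^ (2 * k + 1) = (p - 1) * p * (p ^ k * p ^ k) by ring]
  generalize (p : ℤ) ^ k = P at *
  have h3 : P ≤ P * P := le_mul_of_one_le_left (by linarith) hpk
  have h4 : ((p : ℤ) - 1) * p * P ≤ (p - 1) * p * (P * P) :=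
    mul_le_mul_of_nonneg_left h3 (mul_nonneg (by linarith) (by linarith))
  have h5 : 0 < (((p : ℤ) - 3) * (p + 1) + 2) * P := by
    refine mul_pos ?_ (by linarith)
    have := mul_nonneg (sub_nonneg.2 hp3) (show (0 : ℤ) ≤ p + 1 by linarith)
    linarith
  linarith

end WeightCounts

/-! ### Sums over residue classes -/

section ResidueSums

variable {K : Type*} [Field K] [Fintype K] [DecidableEq K]

/-- Each of the two nonzero values of the quadratic character is taken `(q - 1) / 2` times; the
factor `2` keeps the count in `ℤ`. -/
theorem two_mul_sum_ite_quadraticChar (hK : ringChar K ≠ 2) {σ : ℤ} (hσ : σ ^ 2 = 1) (c : ℤ) :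
    2 * ∑ r : K, (if quadraticChar K r = σ then c else 0) = (Fintype.card K - 1) * c := by
  have h : ∀ r : K, 2 * (if quadraticChar K r = σ then c else 0) =
      c * (1 - if r = 0 then 1 else 0) + σ * c * quadraticChar K r := by
    intro r
    rcases eq_or_ne r 0 with rfl | hr
    · have : (0 : ℤ) ≠ σ := by
        rintro rfl
        simp at hσ
      simp [this]
    · rw [if_neg hr]
      rcases sq_eq_one_iff.1 hσ with rfl | rfl <;>
      rcases quadraticChar_dichotomy hr with h | h <;> rw [h] <;> norm_num <;> ring
  simp only [mul_sum, h]
  rw [sum_add_distrib, ← mul_sum, ← mul_sum, quadraticChar_sum_zero hK, sum_sub_distrib]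
  simp [mul_comm]

theorem sum_ite_sq_eq (hK : ringChar K ≠ 2) (a : K) (c : ℤ) :
    ∑ t : K, (if t ^ 2 = a then c else 0) = (quadraticChar K a + 1) * c := by
  have h := quadraticChar_card_sqrts hK a
  rw [Set.toFinset_ofPred] at h
  rw [← sum_filter, sum_const, nsmul_eq_mul, h]

theorem sum_quadraticChar_mul_left (hK : ringChar K ≠ 2) (a : K) :
    ∑ r : K, quadraticChar K (a * r) = 0 := by
  simp only [map_mul, ← mul_sum, quadraticChar_sum_zero hK, mul_zero]

end ResidueSums

/-! ### Coefficients of the weight formula -/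

section Tables

open QuadraticMap

variable {p : ℕ} [Fact p.Prime]

theorem card_weights_le_of_hasWeightTable {n : ℕ} {C : Submodule (ZMod p) (Fin n → ZMod p)}
    {a : ℚ} {T : List (ℤ × ℚ)} (h : HasWeightTable C ((0, a) :: T)) :
    #((Icc 1 n).filter fun w : ℕ => weightCount C w ≠ 0) ≤ T.length := by
  classical
  calc #((Icc 1 n).filter fun w : ℕ => weightCount C w ≠ 0)
      = #(((Icc 1 n).filter fun w : ℕ => weightCount C w ≠ 0).image (Nat.cast : ℕ → ℤ)) :=
        (card_image_of_injective _ Nat.cast_injective).symm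
    _ ≤ #(T.map Prod.fst).toFinset := by
        refine card_le_card fun w hw => ?_
        obtain ⟨v, hv, rfl⟩ := mem_image.1 hw
        rw [mem_filter, mem_Icc] at hv
        by_contra hT
        refine hv.2 (h.2 _ fun r hr hvr => ?_)
        rcases List.mem_cons.1 hr with rfl | hr
        · have : v = 0 := Int.natCast_eq_zero.1 hvr
          omega
        · exact hT (List.mem_toFinset.2 (List.mem_map.2 ⟨r, hr, hvr.symm⟩))
    _ ≤ T.length := (List.toFinset_card_le _).trans_eq (List.length_map _)

/-- The coefficient `κ` of the weight formula when `p` divides the degree. The case `r = 0` is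
covered by `η(0) = 0`. -/
def weightCoeffZero (p : ℕ) [Fact p.Prime] (r t : ZMod p) : ℤ :=
  if t = 0 then -(p - 1) * quadraticChar (ZMod p) r else quadraticChar (ZMod p) r

/-- The coefficient `κ` of the weight formula when the degree is `μ ≠ 0` modulo `p`. -/
def weightCoeffNonzero (p : ℕ) [Fact p.Prime] (μ r t : ZMod p) : ℤ :=
  if r = 0 then if t = 0 then 0 else (p : ℤ)
  else if t ^ 2 = μ * r then 1 else p + quadraticChar (ZMod p) (μ * r)

theorem three_le_cast (hp : p ≠ 2) : (3 : ℤ) ≤ p := by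
  have h1 := (Fact.out : p.Prime).two_le
  have : 3 ≤ p := by omega
  exact_mod_cast this

theorem quadraticChar_trichotomy (r : ZMod p) :
    r = 0 ∧ quadraticChar (ZMod p) r = 0 ∨ r ≠ 0 ∧ quadraticChar (ZMod p) r = 1 ∨
      r ≠ 0 ∧ quadraticChar (ZMod p) r = -1 := by
  rcases eq_or_ne r 0 with rfl | hr
  · simp
  · rcases quadraticChar_dichotomy hr with h | h <;> simp [hr, h]

theorem abs_weightCoeffZero_le (hp : p ≠ 2) (r t : ZMod p) :
    |weightCoeffZero p r t| ≤ p + 1 := by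
  have h3 := three_le_cast hp
  rw [abs_le, weightCoeffZero]
  rcases quadraticChar_trichotomy r with ⟨-, h2⟩ | ⟨-, h2⟩ | ⟨-, h2⟩ <;> rw [h2] <;>
    split_ifs <;> constructor <;> linarith

theorem abs_weightCoeffNonzero_le (hp : p ≠ 2) (μ r t : ZMod p) :
    |weightCoeffNonzero p μ r t| ≤ p + 1 := by
  have h3 := three_le_cast hp
  rw [abs_le, weightCoeffNonzero]
  rcases quadraticChar_trichotomy (μ * r) with ⟨-, h2⟩ | ⟨-, h2⟩ | ⟨-, h2⟩ <;> rw [h2] <;>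
    split_ifs <;> constructor <;> linarith

theorem weightCoeffZero_eq_zero_iff (hp : p ≠ 2) (r t : ZMod p) :
    weightCoeffZero p r t = 0 ↔ r = 0 := by
  have h3 := three_le_cast hp
  rw [weightCoeffZero]
  rcases quadraticChar_trichotomy r with ⟨h1, h2⟩ | ⟨h1, h2⟩ | ⟨h1, h2⟩ <;> rw [h2] <;>
    split_ifs <;> simp only [h1, iff_true, iff_false] <;> omega

theorem weightCoeffZero_eq_neg_mul_iff (hp : p ≠ 2) {σ : ℤ} (hσ : σ ^ 2 = 1) (r t : ZMod p) :
    weightCoeffZero p r t = -(p - 1) * σ ↔ quadraticChar (ZMod p) r = σ ∧ t = 0 := by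
  have h3 := three_le_cast hp
  rw [weightCoeffZero]
  rcases sq_eq_one_iff.1 hσ with rfl | rfl <;>
  rcases quadraticChar_trichotomy r with ⟨h1, h2⟩ | ⟨h1, h2⟩ | ⟨h1, h2⟩ <;> rw [h2] <;>
    split_ifs with h4 <;> simp only [h4, and_true, and_false, iff_false] <;> omega

theorem weightCoeffZero_eq_iff (hp : p ≠ 2) {σ : ℤ} (hσ : σ ^ 2 = 1) (r t : ZMod p) :
    weightCoeffZero p r t = σ ↔ quadraticChar (ZMod p) r = σ ∧ t ≠ 0 := by
  have h3 := three_le_cast hp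
  rw [weightCoeffZero]
  rcases sq_eq_one_iff.1 hσ with rfl | rfl <;>
  rcases quadraticChar_trichotomy r with ⟨h1, h2⟩ | ⟨h1, h2⟩ | ⟨h1, h2⟩ <;> rw [h2] <;>
    split_ifs with h4 <;> simp only [ne_eq, h4, not_true, not_false_iff, and_true, and_false,
      iff_false] <;> omega

theorem weightCoeffZero_cases (r t : ZMod p) :
    weightCoeffZero p r t = 0 ∨ weightCoeffZero p r t = -(p - 1) * 1 ∨
      weightCoeffZero p r t = -(p - 1) * -1 ∨ weightCoeffZero p r t = 1 ∨
      weightCoeffZero p r t = -1 := by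
  rw [weightCoeffZero]
  rcases quadraticChar_trichotomy r with ⟨h1, h2⟩ | ⟨h1, h2⟩ | ⟨h1, h2⟩ <;> rw [h2] <;>
    split_ifs <;> simp

theorem weightCoeffNonzero_eq_zero_iff (hp : p ≠ 2) {μ : ZMod p} (hμ : μ ≠ 0) (r t : ZMod p) :
    weightCoeffNonzero p μ r t = 0 ↔ r = 0 ∧ t = 0 := by
  have h3 := three_le_cast hp
  rw [weightCoeffNonzero]
  rcases quadraticChar_trichotomy (μ * r) with ⟨h1, h2⟩ | ⟨h1, h2⟩ | ⟨h1, h2⟩ <;> rw [h2] <;>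
    simp only [mul_eq_zero, hμ, false_or, ne_eq] at h1 <;>
    split_ifs with h4 <;>
    simp only [h1, h4, and_true, and_false, false_and, iff_false] <;> omega

theorem weightCoeffNonzero_eq_iff (hp : p ≠ 2) {μ : ZMod p} (hμ : μ ≠ 0) (r t : ZMod p) :
    weightCoeffNonzero p μ r t = p ↔ r = 0 ∧ t ≠ 0 := by
  have h3 := three_le_cast hp
  rw [weightCoeffNonzero]
  rcases quadraticChar_trichotomy (μ * r) with ⟨h1, h2⟩ | ⟨h1, h2⟩ | ⟨h1, h2⟩ <;> rw [h2] <;>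
    simp only [mul_eq_zero, hμ, false_or, ne_eq] at h1 <;>
    split_ifs with h4 <;>
    simp only [ne_eq, h1, h4, and_true, and_false, false_and, not_true, not_false_iff,
      iff_false] <;> omega

theorem weightCoeffNonzero_eq_one_iff (hp : p ≠ 2) {μ : ZMod p} (hμ : μ ≠ 0) (r t : ZMod p) :
    weightCoeffNonzero p μ r t = 1 ↔ r ≠ 0 ∧ t ^ 2 = μ * r := by
  have h3 := three_le_cast hp
  rw [weightCoeffNonzero]
  rcases quadraticChar_trichotomy (μ * r) with ⟨h1, h2⟩ | ⟨h1, h2⟩ | ⟨h1, h2⟩ <;> rw [h2] <;>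
    simp only [mul_eq_zero, hμ, false_or, ne_eq] at h1 <;>
    split_ifs with h4 <;>
    simp only [ne_eq, h1, h4, and_true, and_false, false_and, not_true, not_false_iff,
      iff_false] <;> omega

theorem weightCoeffNonzero_eq_add_iff (hp : p ≠ 2) {μ : ZMod p} (hμ : μ ≠ 0) {τ : ℤ}
    (hτ : τ ^ 2 = 1) (r t : ZMod p) :
    weightCoeffNonzero p μ r t = p + τ ↔
      quadraticChar (ZMod p) (μ * r) = τ ∧ ¬ t ^ 2 = μ * r := by
  have h3 := three_le_cast hp
  rw [weightCoeffNonzero]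
  rcases sq_eq_one_iff.1 hτ with rfl | rfl <;>
  rcases quadraticChar_trichotomy (μ * r) with ⟨h1, h2⟩ | ⟨h1, h2⟩ | ⟨h1, h2⟩ <;> rw [h2] <;>
    simp only [mul_eq_zero, hμ, false_or, ne_eq] at h1 <;>
    by_cases h4 : t ^ 2 = μ * r <;>
    simp only [h4, if_true, if_false, and_true, and_false, not_true, not_false_iff, iff_false] <;>
    split_ifs <;> (try simp only [iff_false]) <;> omega

theorem weightCoeffNonzero_cases {μ : ZMod p} (hμ : μ ≠ 0) (r t : ZMod p) :
    weightCoeffNonzero p μ r t = 0 ∨ weightCoeffNonzero p μ r t = p ∨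
      weightCoeffNonzero p μ r t = p + 1 ∨ weightCoeffNonzero p μ r t = p + -1 ∨
      weightCoeffNonzero p μ r t = 1 := by
  rw [weightCoeffNonzero]
  rcases quadraticChar_trichotomy (μ * r) with ⟨h1, h2⟩ | ⟨h1, h2⟩ | ⟨h1, h2⟩ <;> rw [h2] <;>
    simp only [mul_eq_zero, hμ, false_or, ne_eq] at h1 <;>
    split_ifs <;> simp

end Tables

/-! ### The weight distribution -/

section Distribution

open QuadraticMap

variable {p : ℕ} [Fact p.Prime]

/-- The summand is the joint distribution of `card_frobeniusForm_trace_of_eq_zero`, with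
`A = p^(m-2)` and `B = ε p^((m-1)/2)`. Likewise in the next two lemmas. -/
theorem sum_weightCoeffZero_zero (hp : p ≠ 2) (A B : ℤ) :
    (∑ r, ∑ t, if weightCoeffZero p r t = 0 then
      A + (if t = 0 then B * quadraticChar (ZMod p) r else 0) else 0) = p * A := by
  simp only [weightCoeffZero_eq_zero_iff hp]
  rw [sum_eq_single 0]
  · simp [ZMod.card]
  · intro r _ hr
    simp [hr]
  · simp

theorem sum_weightCoeffZero_neg_mul (hp : p ≠ 2) {σ : ℤ} (hσ : σ ^ 2 = 1) (A B : ℤ) :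
    2 * (∑ r, ∑ t, if weightCoeffZero p r t = -(p - 1) * σ then
      A + (if t = 0 then B * quadraticChar (ZMod p) r else 0) else 0) =
        (p - 1) * (A + B * σ) := by
  have h := two_mul_sum_ite_quadraticChar (ringChar_zmod_ne_two hp) hσ (A + B * σ)
  rw [ZMod.card] at h
  rw [← h]
  congr 1
  refine sum_congr rfl fun r _ => ?_
  simp only [weightCoeffZero_eq_neg_mul_iff hp hσ]
  rw [sum_eq_single 0]
  · by_cases h1 : quadraticChar (ZMod p) r = σ
    · rw [if_pos ⟨h1, rfl⟩, if_pos rfl, if_pos h1, h1]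
    · rw [if_neg fun hc => h1 hc.1, if_neg h1]
  · intro t _ ht
    simp [ht]
  · simp

theorem sum_weightCoeffZero_sign (hp : p ≠ 2) {σ : ℤ} (hσ : σ ^ 2 = 1) (A B : ℤ) :
    2 * (∑ r, ∑ t, if weightCoeffZero p r t = σ then
      A + (if t = 0 then B * quadraticChar (ZMod p) r else 0) else 0) =
        (p - 1) * ((p - 1) * A) := by
  have h := two_mul_sum_ite_quadraticChar (ringChar_zmod_ne_two hp) hσ (((p : ℤ) - 1) * A)
  rw [ZMod.card] at h
  rw [← h]
  congr 1
  refine sum_congr rfl fun r _ => ?_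
  simp only [weightCoeffZero_eq_iff hp hσ]
  split_ifs with h1
  · rw [sum_congr rfl (g := fun t => A - if t = 0 then A else 0)]
    · simp only [sum_sub_distrib, sum_const, card_univ, ZMod.card, sum_ite_eq', mem_univ,
        if_true, nsmul_eq_mul]
      ring
    · intro t _
      by_cases ht : t = 0
      · simp [ht]
      · rw [if_pos ⟨h1, ht⟩, if_neg ht, if_neg ht]
        ring
  · exact sum_eq_zero fun t _ => if_neg fun hc => h1 hc.1

/-- The summand is the joint distribution of `card_frobeniusForm_trace_of_ne_zero`, with
`A = p^(m-2)` and `D = η(m) ε p^((m-3)/2)`. Likewise in the next three lemmas. -/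
theorem sum_weightCoeffNonzero_zero (hp : p ≠ 2) {μ : ZMod p} (hμ : μ ≠ 0) (A D : ℤ) :
    (∑ r, ∑ t, if weightCoeffNonzero p μ r t = 0 then
      A + D * ((if t ^ 2 = μ * r then (p : ℤ) else 0) - 1) else 0) = A + D * (p - 1) := by
  simp only [weightCoeffNonzero_eq_zero_iff hp hμ]
  rw [sum_eq_single 0, sum_eq_single 0]
  · simp
  · intro t _ ht
    simp [ht]
  · simp
  · intro r _ hr
    simp [hr]
  · simp

theorem sum_weightCoeffNonzero_card (hp : p ≠ 2) {μ : ZMod p} (hμ : μ ≠ 0) (A D : ℤ) :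
    (∑ r, ∑ t, if weightCoeffNonzero p μ r t = p then
      A + D * ((if t ^ 2 = μ * r then (p : ℤ) else 0) - 1) else 0) = (p - 1) * (A - D) := by
  simp only [weightCoeffNonzero_eq_iff hp hμ]
  rw [sum_eq_single 0]
  · rw [sum_congr rfl (g := fun t => (A - D) - if t = 0 then A - D else 0)]
    · simp only [sum_sub_distrib, sum_const, card_univ, ZMod.card, sum_ite_eq', mem_univ,
        if_true, nsmul_eq_mul]
      ring
    · intro t _
      by_cases ht : t = 0
      · simp [ht]
      · have ht2 : ¬ t ^ 2 = μ * 0 := by rwa [mul_zero, pow_eq_zero_iff two_ne_zero]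
        rw [if_pos ⟨rfl, ht⟩, if_neg ht, if_neg ht2]
        ring
  · intro r _ hr
    simp [hr]
  · simp

theorem sum_weightCoeffNonzero_one (hp : p ≠ 2) {μ : ZMod p} (hμ : μ ≠ 0) (A D : ℤ) :
    (∑ r, ∑ t, if weightCoeffNonzero p μ r t = 1 then
      A + D * ((if t ^ 2 = μ * r then (p : ℤ) else 0) - 1) else 0) =
        (p - 1) * (A + D * (p - 1)) := by
  have hK := ringChar_zmod_ne_two hp
  have h : ∀ r : ZMod p, (∑ t, if weightCoeffNonzero p μ r t = 1 then
      A + D * ((if t ^ 2 = μ * r then (p : ℤ) else 0) - 1) else 0) =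
      quadraticChar (ZMod p) (μ * r) * (A + D * (p - 1)) +
        ((A + D * (p - 1)) - if r = 0 then A + D * (p - 1) else 0) := by
    intro r
    simp only [weightCoeffNonzero_eq_one_iff hp hμ]
    by_cases hr : r = 0
    · simp [hr]
    · have h1 := sum_ite_sq_eq hK (μ * r) (A + D * (p - 1))
      rw [if_neg hr, sub_zero, ← add_one_mul, ← h1]
      refine sum_congr rfl fun t _ => ?_
      by_cases ht : t ^ 2 = μ * r
      · rw [if_pos ⟨hr, ht⟩, if_pos ht, if_pos ht]
      · rw [if_neg fun hc => ht hc.2, if_neg ht]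
  simp only [h]
  rw [sum_add_distrib, ← sum_mul, sum_quadraticChar_mul_left hK, sum_sub_distrib]
  simp only [sum_const, card_univ, ZMod.card, sum_ite_eq', mem_univ, if_true, nsmul_eq_mul]
  ring

theorem sum_weightCoeffNonzero_add (hp : p ≠ 2) {μ : ZMod p} (hμ : μ ≠ 0) {τ : ℤ}
    (hτ : τ ^ 2 = 1) (A D : ℤ) :
    2 * (∑ r, ∑ t, if weightCoeffNonzero p μ r t = p + τ then
      A + D * ((if t ^ 2 = μ * r then (p : ℤ) else 0) - 1) else 0) =
        (p - 1) * ((p - 1 - τ) * (A - D)) := by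
  have hK := ringChar_zmod_ne_two hp
  have h := two_mul_sum_ite_quadraticChar hK hτ (((p : ℤ) - 1 - τ) * (A - D))
  rw [ZMod.card, ← Equiv.sum_comp (Equiv.mulLeft₀ μ hμ)] at h
  rw [← h]
  congr 1
  refine sum_congr rfl fun r _ => ?_
  rw [Equiv.mulLeft₀_apply]
  simp only [weightCoeffNonzero_eq_add_iff hp hμ hτ]
  split_ifs with h1
  · rw [sum_congr rfl (g := fun t => (A - D) - if t ^ 2 = μ * r then A - D else 0)]
    · rw [sum_sub_distrib, sum_ite_sq_eq hK, h1, sum_const, card_univ, ZMod.card, nsmul_eq_mul]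
      ring
    · intro t _
      by_cases ht : t ^ 2 = μ * r
      · rw [if_neg fun hc => hc.2 ht, if_pos ht, sub_self]
      · rw [if_pos ⟨h1, ht⟩, if_neg ht, if_neg ht]
        ring
  · exact sum_eq_zero fun t _ => if_neg fun hc => h1 hc.1

variable {F : Type*} [Field F] [Fintype F] [Algebra (ZMod p) F] {k n : ℕ} {d : Fin n → F}
  {φ : F ≃ₗ[ZMod p] F}

theorem codeSign_sq (p m : ℕ) : codeSign p m ^ 2 = 1 := by
  rw [codeSign, ← pow_mul, mul_comm, pow_mul, neg_one_sq, one_pow]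

theorem natCast_pow_ne_zero : (p : ℤ) ^ k ≠ 0 :=
  pow_ne_zero _ (by exact_mod_cast (Fact.out : p.Prime).ne_zero)

theorem hasWeightFormula_of_eq_zero (hp : p ≠ 2)
    (hF : Module.finrank (ZMod p) F = 2 * k + 3) (hd : Function.Injective d)
    (hD : Set.range d = definingSet p F) (hm : ((2 * k + 3 : ℕ) : ZMod p) = 0)
    (hφ : ∀ z y, Algebra.trace (ZMod p) F (φ z * y) = polar (frobeniusForm (ZMod p) F) z y) :
    HasWeightFormula d φ (weightCoeffZero p) ((p - 1) * p ^ (2 * k + 1))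
      (codeSign p (2 * k + 3) * p ^ k) := by
  have hε := codeSign_sq p (2 * k + 3)
  refine ⟨mul_ne_zero (fun h => ?_) natCast_pow_ne_zero,
    fun r t => weight_pos hp hε (abs_weightCoeffZero_le hp r t), fun z hz =>
    hammingNorm_traceCodeword_of_eq_zero hp hF hd hD hm hz (hφ z)⟩
  rw [h] at hε
  simp at hε

theorem hasWeightFormula_of_ne_zero (hp : p ≠ 2)
    (hF : Module.finrank (ZMod p) F = 2 * k + 3) (hd : Function.Injective d)
    (hD : Set.range d = definingSet p F) (hm : ((2 * k + 3 : ℕ) : ZMod p) ≠ 0)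
    (hφ : ∀ z y, Algebra.trace (ZMod p) F (φ z * y) = polar (frobeniusForm (ZMod p) F) z y) :
    HasWeightFormula d φ (weightCoeffNonzero p ((2 * k + 3 : ℕ) : ZMod p))
      ((p - 1) * p ^ (2 * k + 1))
      (quadraticChar (ZMod p) ((2 * k + 3 : ℕ) : ZMod p) * codeSign p (2 * k + 3) * p ^ k) := by
  have hε : (quadraticChar (ZMod p) ((2 * k + 3 : ℕ) : ZMod p) * codeSign p (2 * k + 3)) ^ 2
      = 1 := by
    rw [mul_pow, codeSign_sq, quadraticChar_sq_one hm, one_mul]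
  refine ⟨mul_ne_zero (fun h => ?_) natCast_pow_ne_zero,
    fun r t => weight_pos hp hε (abs_weightCoeffNonzero_le hp _ r t), fun z hz =>
    hammingNorm_traceCodeword_of_ne_zero hp hF hd hD hm hz (hφ z)⟩
  rw [h] at hε
  simp at hε

theorem hasWeightTable_weightTableZero (hp : p ≠ 2)
    (hF : Module.finrank (ZMod p) F = 2 * k + 3) (hm : ((2 * k + 3 : ℕ) : ZMod p) = 0)
    (h : HasWeightFormula d φ (weightCoeffZero p) ((p - 1) * p ^ (2 * k + 1))
      (codeSign p (2 * k + 3) * p ^ k)) :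
    HasWeightTable (traceCode p d) (weightTableZero p (2 * k + 3) (codeSign p (2 * k + 3))) := by
  have h3 := three_le_cast hp
  have hε := codeSign_sq p (2 * k + 3)
  have hA : ∀ c : ℤ, |c| ≤ p + 1 → _ := fun c hc => h.weightCount_add (weight_pos hp hε hc)
  simp only [card_frobeniusForm_trace_of_eq_zero hp hF hm] at hA
  simp only [mul_right_comm (codeSign p (2 * k + 3)) _ ((p : ℤ) ^ (k + 1))] at hA
  have hz := h.weightCount_zero
  have hnone := fun w => h.weightCount_eq_zero (w := w)
  clear h
  generalize codeSign p (2 * k + 3) = ε at *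
  have h00 : weightCoeffZero p 0 0 = 0 := by simp [weightCoeffZero]
  have e0 := hA 0 (by rw [abs_le]; constructor <;> linarith)
  rw [sum_weightCoeffZero_zero hp, h00, if_pos rfl] at e0
  have e1 : ∀ σ : ℤ, σ ^ 2 = 1 → _ := fun σ hσ => hA (-(p - 1) * σ)
    (by rw [abs_le]; rcases sq_eq_one_iff.1 hσ with rfl | rfl <;> constructor <;> linarith)
  have e2 : ∀ σ : ℤ, σ ^ 2 = 1 → _ := fun σ hσ => hA σ
    (by rw [abs_le]; rcases sq_eq_one_iff.1 hσ with rfl | rfl <;> constructor <;> linarith)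
  replace e1 : ∀ σ : ℤ, σ ^ 2 = 1 → 2 * (weightCount (traceCode p d)
      ((p - 1) * p ^ (2 * k + 1) + -(p - 1) * σ * (ε * p ^ k)) : ℤ) =
      (p - 1) * (p ^ (2 * k + 1) + ε * p ^ (k + 1) * σ) := by
    intro σ hσ
    rw [e1 σ hσ, h00, if_neg, sub_zero, sum_weightCoeffZero_neg_mul hp hσ]
    rcases sq_eq_one_iff.1 hσ with rfl | rfl <;> omega
  replace e2 : ∀ σ : ℤ, σ ^ 2 = 1 → 2 * (weightCount (traceCode p d)
      ((p - 1) * p ^ (2 * k + 1) + σ * (ε * p ^ k)) : ℤ) =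
      (p - 1) * ((p - 1) * p ^ (2 * k + 1)) := by
    intro σ hσ
    rw [e2 σ hσ, h00, if_neg, sub_zero, sum_weightCoeffZero_sign hp hσ]
    rcases sq_eq_one_iff.1 hσ with rfl | rfl <;> omega
  have x1 : 2 * k + 3 - 1 = 2 * k + 2 := by omega
  have x2 : 2 * k + 3 - 2 = 2 * k + 1 := by omega
  have x3 : (2 * k + 3 - 3) / 2 = k := by omega
  have x4 : (2 * k + 2) / 2 = k + 1 := by omega
  simp only [HasWeightTable, weightTableZero, List.mem_cons, List.not_mem_nil, or_false,
    forall_eq_or_imp, forall_eq, x1, x2, x3, x4]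
  refine ⟨⟨by rw [hz, Nat.cast_one], ?_, ?_, ?_, ?_, ?_⟩, ?_⟩
  · have e := congrArg (Int.cast : ℤ → ℚ) e0
    rw [show ((p : ℤ) - 1) * p ^ (2 * k + 1) + 0 * (ε * p ^ k) = (p - 1) * p ^ (2 * k + 1) by
      ring] at e
    push_cast at e
    linear_combination e
  · have e := congrArg (Int.cast : ℤ → ℚ) (e1 1 (by norm_num))
    rw [show ((p : ℤ) - 1) * p ^ (2 * k + 1) + -(p - 1) * 1 * (ε * p ^ k) =
      (p - 1) * (p ^ (2 * k + 1) - ε * p ^ k) by ring] at e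
    push_cast at e
    linear_combination 1 / 2 * e
  · have e := congrArg (Int.cast : ℤ → ℚ) (e1 (-1) (by norm_num))
    rw [show ((p : ℤ) - 1) * p ^ (2 * k + 1) + -(p - 1) * -1 * (ε * p ^ k) =
      (p - 1) * (p ^ (2 * k + 1) + ε * p ^ k) by ring] at e
    push_cast at e
    linear_combination 1 / 2 * e
  · have e := congrArg (Int.cast : ℤ → ℚ) (e2 1 (by norm_num))
    rw [one_mul] at e
    push_cast at e
    linear_combination 1 / 2 * e
  · have e := congrArg (Int.cast : ℤ → ℚ) (e2 (-1) (by norm_num))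
    rw [show ((p : ℤ) - 1) * p ^ (2 * k + 1) + -1 * (ε * p ^ k) =
      (p - 1) * p ^ (2 * k + 1) - ε * p ^ k by ring] at e
    push_cast at e
    linear_combination 1 / 2 * e
  · rintro w ⟨n0, n1, n2, n3, n4, n5⟩
    refine hnone w n0 fun r t hw => ?_
    rcases weightCoeffZero_cases r t with hc | hc | hc | hc | hc <;> rw [hc] at hw
    · exact n1 (hw.trans (by ring))
    · exact n2 (hw.trans (by ring))
    · exact n3 (hw.trans (by ring))
    · exact n4 (hw.trans (by ring))
    · exact n5 (hw.trans (by ring))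

theorem hasWeightTable_weightTableNonzero (hp : p ≠ 2)
    (hF : Module.finrank (ZMod p) F = 2 * k + 3) (hm : ((2 * k + 3 : ℕ) : ZMod p) ≠ 0)
    (h : HasWeightFormula d φ (weightCoeffNonzero p ((2 * k + 3 : ℕ) : ZMod p))
      ((p - 1) * p ^ (2 * k + 1))
      (quadraticChar (ZMod p) ((2 * k + 3 : ℕ) : ZMod p) * codeSign p (2 * k + 3) * p ^ k)) :
    HasWeightTable (traceCode p d) (weightTableNonzero p (2 * k + 3)
      (quadraticChar (ZMod p) ((2 * k + 3 : ℕ) : ZMod p) * codeSign p (2 * k + 3))) := by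
  have h3 := three_le_cast hp
  have hδ : (quadraticChar (ZMod p) ((2 * k + 3 : ℕ) : ZMod p) * codeSign p (2 * k + 3)) ^ 2
      = 1 := by
    rw [mul_pow, codeSign_sq, quadraticChar_sq_one hm, one_mul]
  have hA : ∀ c : ℤ, |c| ≤ p + 1 → _ := fun c hc => h.weightCount_add (weight_pos hp hδ hc)
  simp only [card_frobeniusForm_trace_of_ne_zero hp hF hm] at hA
  have hz := h.weightCount_zero
  have hnone := fun w => h.weightCount_eq_zero (w := w)
  clear h
  generalize quadraticChar (ZMod p) ((2 * k + 3 : ℕ) : ZMod p) * codeSign p (2 * k + 3) = δ at *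
  generalize ((2 * k + 3 : ℕ) : ZMod p) = μ at *
  have h00 : weightCoeffNonzero p μ 0 0 = 0 := by simp [weightCoeffNonzero]
  have e0 := hA 0 (by rw [abs_le]; constructor <;> linarith)
  rw [sum_weightCoeffNonzero_zero hp hm, h00, if_pos rfl] at e0
  have e1 := hA p (by rw [abs_le]; constructor <;> linarith)
  rw [sum_weightCoeffNonzero_card hp hm, h00, if_neg (by omega), sub_zero] at e1
  have e2 := hA 1 (by rw [abs_le]; constructor <;> linarith)
  rw [sum_weightCoeffNonzero_one hp hm, h00, if_neg (by omega), sub_zero] at e2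
  have e3 : ∀ τ : ℤ, τ ^ 2 = 1 → 2 * (weightCount (traceCode p d)
      ((p - 1) * p ^ (2 * k + 1) + (p + τ) * (δ * p ^ k)) : ℤ) =
      (p - 1) * ((p - 1 - τ) * (p ^ (2 * k + 1) - δ * p ^ k)) := by
    intro τ hτ
    rw [hA (p + τ)
      (by rw [abs_le]; rcases sq_eq_one_iff.1 hτ with rfl | rfl <;> constructor <;> linarith),
      h00, if_neg, sub_zero, sum_weightCoeffNonzero_add hp hm hτ]
    rcases sq_eq_one_iff.1 hτ with rfl | rfl <;> omega
  have x1 : 2 * k + 3 - 1 = 2 * k + 2 := by omega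
  have x2 : 2 * k + 3 - 2 = 2 * k + 1 := by omega
  have x3 : (2 * k + 3 - 3) / 2 = k := by omega
  have x4 : (2 * k + 2) / 2 = k + 1 := by omega
  simp only [HasWeightTable, weightTableNonzero, List.mem_cons, List.not_mem_nil, or_false,
    forall_eq_or_imp, forall_eq, x1, x2, x3, x4]
  refine ⟨⟨by rw [hz, Nat.cast_one], ?_, ?_, ?_, ?_, ?_⟩, ?_⟩
  · have e := congrArg (Int.cast : ℤ → ℚ) e0
    rw [show ((p : ℤ) - 1) * p ^ (2 * k + 1) + 0 * (δ * p ^ k) = (p - 1) * p ^ (2 * k + 1) by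
      ring] at e
    push_cast at e
    linear_combination e
  · have e := congrArg (Int.cast : ℤ → ℚ) e1
    rw [show ((p : ℤ) - 1) * p ^ (2 * k + 1) + p * (δ * p ^ k) =
      (p - 1) * p ^ (2 * k + 1) + δ * p ^ (k + 1) by ring] at e
    push_cast at e
    linear_combination e
  · have e := congrArg (Int.cast : ℤ → ℚ) (e3 1 (by norm_num))
    rw [show ((p : ℤ) - 1) * p ^ (2 * k + 1) + (p + 1) * (δ * p ^ k) =
      (p - 1) * p ^ (2 * k + 1) + δ * (p + 1) * p ^ k by ring] at e
    push_cast at e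
    linear_combination 1 / 2 * e
  · have e := congrArg (Int.cast : ℤ → ℚ) (e3 (-1) (by norm_num))
    rw [show ((p : ℤ) - 1) * p ^ (2 * k + 1) + (p + -1) * (δ * p ^ k) =
      (p - 1) * p ^ (2 * k + 1) + δ * (p - 1) * p ^ k by ring] at e
    push_cast at e
    linear_combination 1 / 2 * e
  · have e := congrArg (Int.cast : ℤ → ℚ) e2
    rw [one_mul] at e
    push_cast at e
    linear_combination e
  · rintro w ⟨n0, n1, n2, n3, n4, n5⟩
    refine hnone w n0 fun r t hw => ?_
    rcases weightCoeffNonzero_cases hm r t with hc | hc | hc | hc | hc <;> rw [hc] at hw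
    · exact n1 (hw.trans (by ring))
    · exact n2 (hw.trans (by ring))
    · exact n3 (hw.trans (by ring))
    · exact n4 (hw.trans (by ring))
    · exact n5 (hw.trans (by ring))

end Distribution

theorem theorem1 (p m : ℕ) [Fact p.Prime] (hp : p ≠ 2) (hm : 3 ≤ m) (hodd : Odd m)
    (F : Type*) [Field F] [Finite F] [Algebra (ZMod p) F] (hF : Nat.card F = p ^ m)
    (n : ℕ) (d : Fin n → F) (hd : Function.Injective d) (hD : Set.range d = definingSet p F) :
    (n : ℤ) = p ^ (m - 1) - 1
        + codeSign p m * quadraticChar (ZMod p) (m : ZMod p) * p ^ ((m - 1) / 2) ∧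
    Module.finrank (ZMod p) (traceCode p d) = m ∧
    ((Finset.Icc 1 n).filter fun w : ℕ => weightCount (traceCode p d) w ≠ 0).card ≤ 5 ∧
    (m % p = 0 → HasWeightTable (traceCode p d) (weightTableZero p m (codeSign p m))) ∧
    (m % p ≠ 0 → HasWeightTable (traceCode p d)
      (weightTableNonzero p m (quadraticChar (ZMod p) (m : ZMod p) * codeSign p m))) := by
  have := Fintype.ofFinite F
  obtain ⟨k, rfl⟩ : ∃ k, m = 2 * k + 3 := by
    obtain ⟨j, rfl⟩ := hodd
    exact ⟨j - 1, by omega⟩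
  have hfin : Module.finrank (ZMod p) F = 2 * k + 3 := by
    rw [Nat.card_eq_fintype_card, ← FiniteField.pow_finrank_eq_card p F] at hF
    exact Nat.pow_right_injective (Fact.out : p.Prime).two_le hF
  obtain ⟨φ, hφ⟩ := exists_equiv_trace_mul_eq_polar (F := F) hp (by rwa [hfin])
  refine ⟨?_, ?_⟩
  · rw [length_eq hp hfin hd hD, show 2 * k + 3 - 1 = 2 * k + 2 by omega,
      show (2 * k + 2) / 2 = k + 1 by omega]
  · by_cases h0 : ((2 * k + 3 : ℕ) : ZMod p) = 0
    · have h1 : (2 * k + 3) % p = 0 :=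
        Nat.mod_eq_zero_of_dvd ((ZMod.natCast_eq_zero_iff _ _).1 h0)
      have hW := hasWeightFormula_of_eq_zero hp hfin hd hD h0 hφ
      have hT := hasWeightTable_weightTableZero hp hfin h0 hW
      exact ⟨hW.finrank.trans hfin, card_weights_le_of_hasWeightTable hT, fun _ => hT,
        fun h => absurd h1 h⟩
    · have h1 : (2 * k + 3) % p ≠ 0 := fun h =>
        h0 ((ZMod.natCast_eq_zero_iff _ _).2 (Nat.dvd_of_mod_eq_zero h))
      have hW := hasWeightFormula_of_ne_zero hp hfin hd hD h0 hφ
      have hT := hasWeightTable_weightTableNonzero hp hfin h0 hW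
      exact ⟨hW.finrank.trans hfin, card_weights_le_of_hasWeightTable hT,
        fun h => absurd h h1, fun _ => hT⟩
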